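/- Let $p$ be a prime, $q=p^r$ with $r\ge 1$, $\ell\ne p$ a prime and $k=\overline{\mathbf{Q}_\ell}$. For $a\in\mathbf{R}$ let $W^a\subset k^*$ be the set of $\alpha$ with $|\tau(\alpha)|=q^{a/2}$ for every embedding $\tau:k\hookrightarrow\mathbf{C}$, viewed as a set of closed points of $\mathrm{Spec}(k[t,t^{-1}])$. A perfect complex $K\in D_{perf}(k[t,t^{-1}])$ is *pure of weight $0$* if, for every $i\in\mathbf{Z}$, the module $H^i(K)$ is supported set-theoretically on $W^i$. Let $D_{pure,0}\subset D_{perf}(k[t,t^{-1}])$ be the full subcategory of these complexes. Complexes of $k[t,t^{-1}]$-modules are given the monoidal structure $\otimes_k$ with $t$ acting diagonally. $E_1$-algebras in $D_{pure,0}$ are represented by unital differential graded $k$-algebras $A$ with a dg automorphism $t$ whose underlying complex is in $D_{pure,0}$; their modules are represented by pairs $(A,M)$ of such an algebra and a left dg $A$-module $M$ with a compatible automorphism $t$ whose underlying complex is in $D_{pure,0}$ too. Maps of algebras and of pairs commute with $t$; a quasi-isomorphism is a map that induces an isomorphism on cohomology (of the algebra and, for pairs, also of the module). $H^*(A)$ and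 $(H^*(A),H^*(M))$ carry zero differentials and the induced structure. Let $\mathcal C$ be the category of such algebras, or the category of such pairs, let $\mathcal C^{gr}\subset\mathcal C$ be the full subcategory of objects with zero differentials, and for a category $J$ let $\mathrm{Ho}(\mathcal C^J)$ be the localization of the category of functors $J\to\mathcal C$ at the objectwise quasi-isomorphisms. Then: 1. (Splitting) For $K\in D_{pure,0}$ and $i\in\mathbf{Z}$ there is exactly one morphism $s_{K,i}:H^i(K)[-i]\to K$ in $D(k[t,t^{-1}])$ that induces the identity on $H^i$. These morphisms are natural in $K$ and exhibit $K$ as the direct sum $\bigoplus_i H^i(K)[-i]$. 2. (Discreteness) $\mathrm{Ext}^n_{k[t,t^{-1}]}(K,L)=0$ for all $K,L\in D_{pure,0}$ and all $n<0$. 3. (Canonical formality of algebras and of modules) Both for $\mathcal C$ the category of algebras and for $\mathcal C$ the category of pairs: $H^*(X)\in\mathcal C^{gr}$ for all $X\in\mathcal C$, and for every category $J$, - (a) for every functor $F:J\to\mathcal C$ there is exactly one morphism $\alpha_F:F\to H^*\circ F$ in $\mathrm{Ho}(\mathcal C^J)$ that induces the identity on cohomology, and $\alpha_F$ is an isomorphism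 and natural in $F\in\mathcal C^J$; - (b) the functor $\mathcal C^J\to(\mathcal C^{gr})^J$, $F\mapsto H^*\circ F$, is the localization of $\mathcal C^J$ at the objectwise quasi-isomorphisms, i.e. it induces an equivalence $\mathrm{Ho}(\mathcal C^J)\simeq(\mathcal C^{gr})^J$. For $J$ a point, (a) says that every object $X$ of $\mathcal C$ is formal, through a unique isomorphism $X\simeq H^*(X)$ in the homotopy category inducing the identity on cohomology; arbitrary $J$ expresses that this isomorphism is natural and unique up to contractible choice. -/

import Mathlib

open CategoryTheory CategoryTheory.Limits LaurentPolynomial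

universe w v₁ u₁ v₂ u₂

noncomputable section

namespace PureFormality

/-! ### Weil numbers and pure complexes -/

/-- `α` is a Weil number of weight `a` with respect to `q`: every embedding of the field into `ℂ`
sends it to a complex number of absolute value `q ^ (a / 2)`. -/
def IsWeilNumber {k : Type} [Field k] (q : ℕ) (a : ℝ) (α : kˣ) : Prop :=
  ∀ τ : k →+* ℂ, ‖τ (α : k)‖ = (q : ℝ) ^ (a / 2)

/-- The set `W^a ⊆ kˣ` of Weil numbers of weight `a`, as a set of closed points of
`Spec k[t, t⁻¹]`: the number `α` is the point `t = α`. -/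
def weilLocus (k : Type) [Field k] (q : ℕ) (a : ℝ) : Set (PrimeSpectrum k[T;T⁻¹]) :=
  {x | ∃ α : kˣ, IsWeilNumber q a α ∧ x.asIdeal = Ideal.span {T 1 - C (α : k)}}

/-- Cochain complexes of `k[t, t⁻¹]`-modules, i.e. complexes of `k`-vector spaces with a
`k`-linear automorphism `t`. -/
abbrev Cpx (k : Type) [Field k] := CochainComplex (ModuleCat.{0} k[T;T⁻¹]) ℤ

/-- The derived category `D(k[t, t⁻¹])`. -/
abbrev Der (k : Type) [Field k] [HasDerivedCategory.{w} (ModuleCat.{0} k[T;T⁻¹])] :=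
  DerivedCategory (ModuleCat.{0} k[T;T⁻¹])

section
variable (k : Type) [Field k] [HasDerivedCategory.{w} (ModuleCat.{0} k[T;T⁻¹])]

/-- Perfect complexes: those isomorphic in the derived category to a bounded complex of finitely
generated projective modules. -/
def perfect : ObjectProperty (Der.{w} k) := fun K =>
  ∃ P : Cpx k,
    (∃ a b : ℤ, ∀ i : ℤ, i < a ∨ b < i → IsZero (P.X i)) ∧
    (∀ i : ℤ, Module.Finite k[T;T⁻¹] (P.X i) ∧ Module.Projective k[T;T⁻¹] (P.X i)) ∧
    Nonempty (DerivedCategory.Q.obj P ≅ K)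

/-- The perfect complexes that are pure of weight `0`: the `i`-th cohomology is supported
set-theoretically on `W^i`, for every `i`. -/
def IsPure (q : ℕ) : ObjectProperty (Der.{w} k) := fun K =>
  perfect.{w} k K ∧ ∀ i : ℤ,
    Module.support k[T;T⁻¹] ((DerivedCategory.homologyFunctor (ModuleCat.{0} k[T;T⁻¹]) i).obj K) ⊆ weilLocus k q i

end

variable {k : Type} [Field k]

/-! ### Cohomology of a complex, as a complex with zero differential -/

/-- The `i`-cocycles. -/
def cocycles (K : Cpx k) (i : ℤ) : Submodule k[T;T⁻¹] (K.X i) :=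
  LinearMap.ker (K.d i (i + 1)).hom

/-- The `i`-coboundaries. -/
def coboundaries (K : Cpx k) (i : ℤ) : Submodule k[T;T⁻¹] (K.X i) :=
  LinearMap.range (K.d (i - 1) i).hom

/-- `H^i(K)`. -/
abbrev Coh (K : Cpx k) (i : ℤ) : Type :=
  cocycles K i ⧸ (coboundaries K i).submoduleOf (cocycles K i)

theorem mem_cocycles {K : Cpx k} {i : ℤ} {x : K.X i} :
    x ∈ cocycles K i ↔ (K.d i (i + 1)).hom x = 0 := Iff.rfl

theorem mem_coboundaries {K : Cpx k} {p i : ℤ} (hp : p + 1 = i) {x : K.X i} :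
    x ∈ coboundaries K i ↔ ∃ y, (K.d p i).hom y = x := by
  obtain rfl : p = i - 1 := by omega
  exact Iff.rfl

/-- The cohomology class of a cocycle. -/
def cls {K : Cpx k} {i : ℤ} (x : K.X i) (hx : (K.d i (i + 1)).hom x = 0) : Coh K i :=
  Submodule.Quotient.mk ⟨x, hx⟩

theorem cls_eq_iff {K : Cpx k} {p i : ℤ} (hp : p + 1 = i) {x y : K.X i}
    (hx : (K.d i (i + 1)).hom x = 0) (hy : (K.d i (i + 1)).hom y = 0) :
    cls x hx = cls y hy ↔ ∃ z, (K.d p i).hom z = x - y :=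
  (Submodule.Quotient.eq _).trans (mem_coboundaries hp)

theorem exists_cls {K : Cpx k} {i : ℤ} (c : Coh K i) :
    ∃ (x : K.X i) (hx : (K.d i (i + 1)).hom x = 0), cls x hx = c := by
  obtain ⟨⟨x, hx⟩, rfl⟩ := Submodule.Quotient.mk_surjective _ c
  exact ⟨x, hx, rfl⟩

theorem hom_d {K L : Cpx k} (f : K ⟶ L) (i j : ℤ) (x : K.X i) :
    (L.d i j).hom ((f.f i).hom x) = (f.f j).hom ((K.d i j).hom x) := by
  exact LinearMap.congr_fun (congrArg ModuleCat.Hom.hom (f.comm i j)) x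

theorem d_d {K : Cpx k} (i j l : ℤ) (x : K.X i) :
    (K.d j l).hom ((K.d i j).hom x) = 0 := by
  exact LinearMap.congr_fun (congrArg ModuleCat.Hom.hom (K.d_comp_d i j l)) x

/-- The map induced on `H^i` by a map of complexes. -/
def cohMap {K L : Cpx k} (f : K ⟶ L) (i : ℤ) : Coh K i →ₗ[k[T;T⁻¹]] Coh L i :=
  Submodule.mapQ _ _
    (LinearMap.restrict (f.f i).hom (p := cocycles K i) (q := cocycles L i) (by
      intro x hx
      rw [mem_cocycles] at hx ⊢
      rw [hom_d, hx, map_zero]))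
    (by
      rintro ⟨x, hx⟩ hxb
      obtain ⟨y, hy⟩ := hxb
      refine ⟨(f.f (i - 1)).hom y, ?_⟩
      rw [hom_d, hy]
      rfl)

@[simp]
theorem cohMap_cls {K L : Cpx k} (f : K ⟶ L) {i : ℤ} (x : K.X i)
    (hx : (K.d i (i + 1)).hom x = 0) :
    cohMap f i (cls x hx) = cls ((f.f i).hom x) (by rw [hom_d, hx, map_zero]) := rfl

/-- `H^*(K)`, as a complex with zero differential and `H^i(K)` in degree `i`. -/
def cohCpx (K : Cpx k) : Cpx k where
  X n := ModuleCat.of _ (Coh K n)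
  d _ _ := 0

/-- The map of complexes `H^*(K) ⟶ H^*(L)` induced by a map of complexes. -/
def cohCpxMap {K L : Cpx k} (f : K ⟶ L) : cohCpx K ⟶ cohCpx L where
  f n := ModuleCat.ofHom (cohMap f n)
  comm' _ _ _ := by simp [cohCpx]

theorem cohCpx_d (K : Cpx k) (i j : ℤ) (x : (cohCpx K).X i) :
    ((cohCpx K).d i j).hom x = 0 := rfl

/-- The tautological map `H^*(K) ⟶ H^*(H^*(K))`, which sends `x` to its class and so expresses
that a complex with zero differential is its own cohomology. -/
def cohCpxSelf (K : Cpx k) : cohCpx K ⟶ cohCpx (cohCpx K) where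
  f _ := ModuleCat.ofHom
    { toFun := fun x => cls (K := cohCpx K) x (cohCpx_d K _ _ x)
      map_add' := fun _ _ => rfl
      map_smul' := fun _ _ => rfl }
  comm' _ _ _ := (comp_zero (f := _)).trans (zero_comp (f := _)).symm

/-! ### Equivariant dg algebras and dg modules

The monoidal structure on complexes of `k[t, t⁻¹]`-modules is the tensor product over `k` with
`t` acting diagonally. `Pairing K L M` is the set of maps of complexes `K ⊗_k L ⟶ M` that commute
with `t`, written out as families of biadditive maps. -/

/-- Maps of complexes of `k[t, t⁻¹]`-modules `K ⊗_k L ⟶ M`, where `t` acts diagonally on the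
tensor product. -/
@[ext]
structure Pairing (K L M : Cpx k) where
  /-- the value on a homogeneous pair of elements -/
  app : ∀ i j n : ℤ, i + j = n → K.X i →+ L.X j →+ M.X n
  smul_left : ∀ (i j n : ℤ) (h : i + j = n) (c : k) (x : K.X i) (y : L.X j),
    app i j n h ((C c : k[T;T⁻¹]) • x) y = (C c : k[T;T⁻¹]) • app i j n h x y
  smul_right : ∀ (i j n : ℤ) (h : i + j = n) (c : k) (x : K.X i) (y : L.X j),
    app i j n h x ((C c : k[T;T⁻¹]) • y) = (C c : k[T;T⁻¹]) • app i j n h x y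
  t_smul : ∀ (i j n : ℤ) (h : i + j = n) (x : K.X i) (y : L.X j),
    app i j n h ((T 1 : k[T;T⁻¹]) • x) ((T 1 : k[T;T⁻¹]) • y)
      = (T 1 : k[T;T⁻¹]) • app i j n h x y
  leibniz : ∀ (i j n : ℤ) (h : i + j = n) (x : K.X i) (y : L.X j),
    (M.d n (n + 1)).hom (app i j n h x y)
      = app (i + 1) j (n + 1) (by omega) ((K.d i (i + 1)).hom x) y
        + i.negOnePow • app i (j + 1) (n + 1) (by omega) x ((L.d j (j + 1)).hom y)

namespace Pairing

variable {K L M : Cpx k} (μ : Pairing K L M)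

theorem leibniz' {i i' j j' n n' : ℤ} (hi : i + 1 = i') (hj : j + 1 = j') (hn : n + 1 = n')
    (h : i + j = n) (x : K.X i) (y : L.X j) :
    (M.d n n').hom (μ.app i j n h x y)
      = μ.app i' j n' (by omega) ((K.d i i').hom x) y
        + i.negOnePow • μ.app i j' n' (by omega) x ((L.d j j').hom y) := by
  subst hi hj hn
  exact μ.leibniz _ _ _ _ _ _

theorem closed {i j n : ℤ} (h : i + j = n) {x : K.X i} {y : L.X j}
    (hx : (K.d i (i + 1)).hom x = 0) (hy : (L.d j (j + 1)).hom y = 0) :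
    (M.d n (n + 1)).hom (μ.app i j n h x y) = 0 := by
  rw [μ.leibniz, hx, hy]
  simp

theorem exact_left {i j n : ℤ} (h : i + j = n) (z : K.X (i - 1)) {y : L.X j}
    (hy : (L.d j (j + 1)).hom y = 0) :
    ∃ w, (M.d (n - 1) n).hom w = μ.app i j n h ((K.d (i - 1) i).hom z) y := by
  refine ⟨μ.app (i - 1) j (n - 1) (by omega) z y, ?_⟩
  rw [μ.leibniz' (i' := i) (j' := j + 1) (by omega) rfl (by omega), hy]
  simp

theorem exact_right {i j n : ℤ} (h : i + j = n) {x : K.X i} (z : L.X (j - 1))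
    (hx : (K.d i (i + 1)).hom x = 0) :
    ∃ w, (M.d (n - 1) n).hom w = μ.app i j n h x ((L.d (j - 1) j).hom z) := by
  refine ⟨i.negOnePow • μ.app i (j - 1) (n - 1) (by omega) x z, ?_⟩
  have := μ.leibniz' (i := i) (i' := i + 1) (j := j - 1) (j' := j) (n := n - 1) (n' := n)
    rfl (by omega) (by omega) (by omega) x z
  rw [hx] at this
  simp only [map_zero, AddMonoidHom.zero_apply, zero_add] at this
  rw [Units.smul_def, map_zsmul, this, Units.smul_def, smul_smul, ← Units.val_mul,
    Int.units_mul_self, Units.val_one, one_smul]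

/-- The product of two cohomology classes. -/
def cohFun (i j n : ℤ) (h : i + j = n) : Coh K i → Coh L j → Coh M n :=
  Quotient.map₂
    (fun x y => ⟨μ.app i j n h x.1 y.1, μ.closed h x.2 y.2⟩)
    (by
      rintro ⟨x, hx⟩ ⟨x', hx'⟩ hxx ⟨y, hy⟩ ⟨y', hy'⟩ hyy
      obtain ⟨a, ha⟩ := (Submodule.quotientRel_def _).1 hxx
      obtain ⟨b, hb⟩ := (Submodule.quotientRel_def _).1 hyy
      obtain ⟨a', ha'⟩ := μ.exact_left h a hy
      obtain ⟨b', hb'⟩ := μ.exact_right h b hx'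
      refine (Submodule.quotientRel_def _).2 ⟨a' + b', ?_⟩
      rw [map_add, ha', hb', ha, hb]
      simp)

theorem cohFun_cls {i j n : ℤ} (h : i + j = n) (x : K.X i) (y : L.X j)
    (hx : (K.d i (i + 1)).hom x = 0) (hy : (L.d j (j + 1)).hom y = 0) :
    μ.cohFun i j n h (cls x hx) (cls y hy) = cls (μ.app i j n h x y) (μ.closed h hx hy) := rfl

theorem add_cls {i : ℤ} (x y : K.X i) (hx : (K.d i (i + 1)).hom x = 0)
    (hy : (K.d i (i + 1)).hom y = 0) :
    cls x hx + cls y hy = cls (x + y) (by rw [map_add, hx, hy, add_zero]) := rfl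

theorem smul_cls {i : ℤ} (r : k[T;T⁻¹]) (x : K.X i) (hx : (K.d i (i + 1)).hom x = 0) :
    r • cls x hx = cls (r • x) (by rw [map_smul, hx, smul_zero]) := rfl

theorem cls_congr {i : ℤ} {x y : K.X i} (hxy : x = y) (hx : (K.d i (i + 1)).hom x = 0)
    (hy : (K.d i (i + 1)).hom y = 0) : cls x hx = cls y hy := by
  subst hxy; rfl

theorem cohFun_add_right (i j n : ℤ) (h : i + j = n) (x : Coh K i) (y y' : Coh L j) :
    μ.cohFun i j n h x (y + y') = μ.cohFun i j n h x y + μ.cohFun i j n h x y' := by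
  obtain ⟨x, hx, rfl⟩ := exists_cls x
  obtain ⟨y, hy, rfl⟩ := exists_cls y
  obtain ⟨y', hy', rfl⟩ := exists_cls y'
  rw [add_cls, cohFun_cls, cohFun_cls, cohFun_cls, add_cls]
  exact cls_congr (map_add _ _ _) _ _

theorem cohFun_add_left (i j n : ℤ) (h : i + j = n) (x x' : Coh K i) (y : Coh L j) :
    μ.cohFun i j n h (x + x') y = μ.cohFun i j n h x y + μ.cohFun i j n h x' y := by
  obtain ⟨x, hx, rfl⟩ := exists_cls x
  obtain ⟨x', hx', rfl⟩ := exists_cls x'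
  obtain ⟨y, hy, rfl⟩ := exists_cls y
  rw [add_cls, cohFun_cls, cohFun_cls, cohFun_cls, add_cls]
  exact cls_congr (by rw [map_add, AddMonoidHom.add_apply]) _ _

theorem cohFun_smul_left (i j n : ℤ) (h : i + j = n) (c : k) (x : Coh K i) (y : Coh L j) :
    μ.cohFun i j n h ((C c : k[T;T⁻¹]) • x) y = (C c : k[T;T⁻¹]) • μ.cohFun i j n h x y := by
  obtain ⟨x, hx, rfl⟩ := exists_cls x
  obtain ⟨y, hy, rfl⟩ := exists_cls y
  rw [smul_cls, cohFun_cls, cohFun_cls, smul_cls]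
  exact cls_congr (μ.smul_left _ _ _ _ _ _ _) _ _

theorem cohFun_smul_right (i j n : ℤ) (h : i + j = n) (c : k) (x : Coh K i) (y : Coh L j) :
    μ.cohFun i j n h x ((C c : k[T;T⁻¹]) • y) = (C c : k[T;T⁻¹]) • μ.cohFun i j n h x y := by
  obtain ⟨x, hx, rfl⟩ := exists_cls x
  obtain ⟨y, hy, rfl⟩ := exists_cls y
  rw [smul_cls, cohFun_cls, cohFun_cls, smul_cls]
  exact cls_congr (μ.smul_right _ _ _ _ _ _ _) _ _

theorem cohFun_t_smul (i j n : ℤ) (h : i + j = n) (x : Coh K i) (y : Coh L j) :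
    μ.cohFun i j n h ((T 1 : k[T;T⁻¹]) • x) ((T 1 : k[T;T⁻¹]) • y)
      = (T 1 : k[T;T⁻¹]) • μ.cohFun i j n h x y := by
  obtain ⟨x, hx, rfl⟩ := exists_cls x
  obtain ⟨y, hy, rfl⟩ := exists_cls y
  rw [smul_cls, smul_cls, cohFun_cls, cohFun_cls, smul_cls]
  exact cls_congr (μ.t_smul _ _ _ _ _ _) _ _

/-- The induced pairing on cohomology, `[x] ⊗ [y] ↦ [x · y]`. -/
def coh : Pairing (cohCpx K) (cohCpx L) (cohCpx M) where
  app i j n h := AddMonoidHom.mk' (M := Coh K i) (G := Coh L j →+ Coh M n)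
    (fun x => AddMonoidHom.mk' (μ.cohFun i j n h x) (μ.cohFun_add_right i j n h x))
    (fun x x' => AddMonoidHom.ext (μ.cohFun_add_left i j n h x x'))
  smul_left := μ.cohFun_smul_left
  smul_right := μ.cohFun_smul_right
  t_smul := μ.cohFun_t_smul
  leibniz i j n h x y := by
    have h₁ : μ.cohFun (i + 1) j (n + 1) (by omega) 0 y = 0 := by
      simpa using μ.cohFun_add_left (i + 1) j (n + 1) (by omega) 0 0 y
    have h₂ : μ.cohFun i (j + 1) (n + 1) (by omega) x 0 = 0 := by
      simpa using μ.cohFun_add_right i (j + 1) (n + 1) (by omega) x 0 0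
    refine Eq.trans (b := (0 : Coh M (n + 1)) + i.negOnePow • (0 : Coh M (n + 1))) ?_ ?_
    · rw [smul_zero, add_zero]
      rfl
    · exact congrArg₂ (fun a b : Coh M (n + 1) => a + i.negOnePow • b) h₁.symm h₂.symm

theorem coh_cls {i j n : ℤ} (h : i + j = n) (x : K.X i) (y : L.X j)
    (hx : (K.d i (i + 1)).hom x = 0) (hy : (L.d j (j + 1)).hom y = 0) :
    μ.coh.app i j n h (cls x hx) (cls y hy) = cls (μ.app i j n h x y) (μ.closed h hx hy) := rfl

end Pairing

variable (k) in
/-- Differential graded `k`-algebras (unital, associative) with an automorphism `t`: the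
associative algebras in complexes of `k[t, t⁻¹]`-modules for the tensor product over `k` with
diagonal action of `t`. Up to quasi-isomorphism these are the `E₁`-algebras in `D(k[t, t⁻¹])`. -/
structure DGAlg where
  /-- the underlying complex -/
  cpx : Cpx k
  /-- the multiplication -/
  mul : Pairing cpx cpx cpx
  /-- the unit -/
  one : cpx.X 0
  d_one : (cpx.d 0 (0 + 1)).hom one = 0
  t_one : (T 1 : k[T;T⁻¹]) • one = one
  one_mul : ∀ (i : ℤ) (x : cpx.X i), mul.app 0 i i (by omega) one x = x
  mul_one : ∀ (i : ℤ) (x : cpx.X i), mul.app i 0 i (by omega) x one = x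
  mul_assoc : ∀ (i j l ij jl n : ℤ) (h₁ : i + j = ij) (h₂ : j + l = jl) (h₃ : ij + l = n)
    (h₄ : i + jl = n) (x : cpx.X i) (y : cpx.X j) (z : cpx.X l),
    mul.app ij l n h₃ (mul.app i j ij h₁ x y) z = mul.app i jl n h₄ x (mul.app j l jl h₂ y z)

namespace DGAlg

/-- Maps of equivariant dg algebras. -/
@[ext]
structure Hom (A B : DGAlg k) where
  /-- the underlying map of complexes -/
  map : A.cpx ⟶ B.cpx
  map_one : (map.f 0).hom A.one = B.one
  map_mul : ∀ (i j n : ℤ) (h : i + j = n) (x : A.cpx.X i) (y : A.cpx.X j),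
    (map.f n).hom (A.mul.app i j n h x y)
      = B.mul.app i j n h ((map.f i).hom x) ((map.f j).hom y)

instance : Category (DGAlg k) where
  Hom := Hom
  id A := ⟨𝟙 _, rfl, fun _ _ _ _ _ _ => rfl⟩
  comp f g := ⟨f.map ≫ g.map, by
      simp [f.map_one, g.map_one], by
      intros
      simp [f.map_mul, g.map_mul]⟩

@[ext]
theorem hom_ext {A B : DGAlg k} {f g : A ⟶ B} (h : f.map = g.map) : f = g := Hom.ext h

@[simp] theorem id_map (A : DGAlg k) : Hom.map (𝟙 A) = 𝟙 A.cpx := rfl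

@[simp] theorem comp_map {A B D : DGAlg k} (f : A ⟶ B) (g : B ⟶ D) :
    (f ≫ g).map = f.map ≫ g.map := rfl

/-- The cohomology algebra `H^*(A)`, with zero differential. -/
def coh (A : DGAlg k) : DGAlg k where
  cpx := cohCpx A.cpx
  mul := A.mul.coh
  one := cls A.one A.d_one
  d_one := cohCpx_d _ _ _ _
  t_one := Pairing.cls_congr A.t_one _ _
  one_mul i x := by
    obtain ⟨x, hx, rfl⟩ := exists_cls x
    exact Pairing.cls_congr (A.one_mul _ _) _ _
  mul_one i x := by
    obtain ⟨x, hx, rfl⟩ := exists_cls x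
    exact Pairing.cls_congr (A.mul_one _ _) _ _
  mul_assoc i j l ij jl n h₁ h₂ h₃ h₄ x y z := by
    obtain ⟨x, hx, rfl⟩ := exists_cls x
    obtain ⟨y, hy, rfl⟩ := exists_cls y
    obtain ⟨z, hz, rfl⟩ := exists_cls z
    exact Pairing.cls_congr (A.mul_assoc _ _ _ _ _ _ _ _ _ _ _ _ _) _ _

variable (k) in
/-- Cohomology `A ↦ H^*(A)` as a functor. -/
def cohFunctor : DGAlg k ⥤ DGAlg k where
  obj A := A.coh
  map {A B} f :=
    { map := cohCpxMap f.map
      map_one := Pairing.cls_congr f.map_one _ _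
      map_mul := by
        intro i j n h x y
        obtain ⟨x, hx, rfl⟩ := exists_cls x
        obtain ⟨y, hy, rfl⟩ := exists_cls y
        exact Pairing.cls_congr (f.map_mul _ _ _ _ _ _) _ _ }
  map_id A := by
    ext i x
    obtain ⟨x, hx, rfl⟩ := exists_cls x
    rfl
  map_comp f g := by
    ext i x
    obtain ⟨x, hx, rfl⟩ := exists_cls x
    rfl

variable (k) in
/-- The tautological maps `H^*(A) ⟶ H^*(H^*(A))`, `x ↦ [x]`. -/
def cohSelf : cohFunctor k ⟶ cohFunctor k ⋙ cohFunctor k where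
  app A :=
    { map := cohCpxSelf A.cpx
      map_one := rfl
      map_mul := fun _ _ _ _ _ _ => rfl }
  naturality _ _ _ := rfl

variable (k) in
/-- The dg algebras with zero differential, i.e. the graded algebras with an automorphism. -/
def zeroDiff : ObjectProperty (DGAlg k) := fun A => ∀ i j, A.cpx.d i j = 0

/-- The dg algebras whose underlying complex is perfect and pure of weight `0`. -/
def isPure (q : ℕ) [HasDerivedCategory.{w} (ModuleCat.{0} k[T;T⁻¹])] :
    ObjectProperty (DGAlg k) := fun A =>
  IsPure.{w} k q (DerivedCategory.Q.obj A.cpx)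

end DGAlg

variable (k) in
/-- Pairs `(A, M)` of a dg algebra and a left dg module over it, both with compatible
automorphisms `t`. -/
structure DGMod where
  /-- the algebra -/
  alg : DGAlg k
  /-- the underlying complex of the module -/
  cpx : Cpx k
  /-- the action -/
  act : Pairing alg.cpx cpx cpx
  one_act : ∀ (i : ℤ) (x : cpx.X i), act.app 0 i i (by omega) alg.one x = x
  act_assoc : ∀ (i j l ij jl n : ℤ) (h₁ : i + j = ij) (h₂ : j + l = jl) (h₃ : ij + l = n)
    (h₄ : i + jl = n) (a : alg.cpx.X i) (b : alg.cpx.X j) (x : cpx.X l),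
    act.app ij l n h₃ (alg.mul.app i j ij h₁ a b) x = act.app i jl n h₄ a (act.app j l jl h₂ b x)

namespace DGMod

/-- Maps of pairs `(A, M) ⟶ (B, N)`: a map of algebras `A ⟶ B` and an `A`-linear map `M ⟶ N`. -/
@[ext]
structure Hom (M N : DGMod k) where
  /-- the map of algebras -/
  algMap : M.alg ⟶ N.alg
  /-- the map of underlying complexes -/
  map : M.cpx ⟶ N.cpx
  map_act : ∀ (i j n : ℤ) (h : i + j = n) (a : M.alg.cpx.X i) (x : M.cpx.X j),
    (map.f n).hom (M.act.app i j n h a x)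
      = N.act.app i j n h ((algMap.map.f i).hom a) ((map.f j).hom x)

instance : Category (DGMod k) where
  Hom := Hom
  id A := ⟨𝟙 _, 𝟙 _, fun _ _ _ _ _ _ => rfl⟩
  comp f g := ⟨f.algMap ≫ g.algMap, f.map ≫ g.map, by
      intros
      simp [f.map_act, g.map_act]⟩

@[ext]
theorem hom_ext {A B : DGMod k} {f g : A ⟶ B} (h₁ : f.algMap = g.algMap) (h : f.map = g.map) :
    f = g := Hom.ext h₁ h

@[simp] theorem id_map (A : DGMod k) : Hom.map (𝟙 A) = 𝟙 A.cpx := rfl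

@[simp] theorem comp_map {A B D : DGMod k} (f : A ⟶ B) (g : B ⟶ D) :
    (f ≫ g).map = f.map ≫ g.map := rfl

@[simp] theorem id_algMap (A : DGMod k) : Hom.algMap (𝟙 A) = 𝟙 A.alg := rfl

@[simp] theorem comp_algMap {A B D : DGMod k} (f : A ⟶ B) (g : B ⟶ D) :
    (f ≫ g).algMap = f.algMap ≫ g.algMap := rfl

/-- The cohomology `(H^*(A), H^*(M))` of a pair, with zero differentials. -/
def coh (M : DGMod k) : DGMod k where
  alg := M.alg.coh
  cpx := cohCpx M.cpx
  act := M.act.coh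
  one_act i x := by
    obtain ⟨x, hx, rfl⟩ := exists_cls x
    exact Pairing.cls_congr (M.one_act _ _) _ _
  act_assoc i j l ij jl n h₁ h₂ h₃ h₄ x y z := by
    obtain ⟨x, hx, rfl⟩ := exists_cls x
    obtain ⟨y, hy, rfl⟩ := exists_cls y
    obtain ⟨z, hz, rfl⟩ := exists_cls z
    exact Pairing.cls_congr (M.act_assoc _ _ _ _ _ _ _ _ _ _ _ _ _) _ _

variable (k) in
/-- Cohomology `(A, M) ↦ (H^*(A), H^*(M))` as a functor. -/
def cohFunctor : DGMod k ⥤ DGMod k where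
  obj M := M.coh
  map {M N} f :=
    { algMap := (DGAlg.cohFunctor k).map f.algMap
      map := cohCpxMap f.map
      map_act := by
        intro i j n h x y
        obtain ⟨x, hx, rfl⟩ := exists_cls x
        obtain ⟨y, hy, rfl⟩ := exists_cls y
        exact Pairing.cls_congr (f.map_act _ _ _ _ _ _) _ _ }
  map_id M := by
    apply hom_ext
    · exact (DGAlg.cohFunctor k).map_id _
    · ext i x
      obtain ⟨x, hx, rfl⟩ := exists_cls x
      rfl
  map_comp f g := by
    apply hom_ext
    · exact (DGAlg.cohFunctor k).map_comp _ _
    · ext i x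
      obtain ⟨x, hx, rfl⟩ := exists_cls x
      rfl

variable (k) in
/-- The tautological maps from the cohomology of a pair to the cohomology of the cohomology. -/
def cohSelf : cohFunctor k ⟶ cohFunctor k ⋙ cohFunctor k where
  app M :=
    { algMap := (DGAlg.cohSelf k).app M.alg
      map := cohCpxSelf M.cpx
      map_act := fun _ _ _ _ _ _ => rfl }
  naturality _ _ _ := rfl

variable (k) in
/-- The pairs with zero differentials, i.e. graded modules over graded algebras. -/
def zeroDiff : ObjectProperty (DGMod k) := fun M =>
  DGAlg.zeroDiff k M.alg ∧ ∀ i j, M.cpx.d i j = 0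

/-- The pairs `(A, M)` for which both underlying complexes are perfect and pure of weight `0`. -/
def isPure (q : ℕ) [HasDerivedCategory.{w} (ModuleCat.{0} k[T;T⁻¹])] :
    ObjectProperty (DGMod k) := fun M =>
  DGAlg.isPure.{w} q M.alg ∧ IsPure.{w} k q (DerivedCategory.Q.obj M.cpx)

end DGMod

/-! ### Canonical formality -/

section Formality

variable {𝒟 : Type u₁} [Category.{v₁} 𝒟] (H : 𝒟 ⥤ 𝒟) (P : ObjectProperty 𝒟)
  (J : Type u₂) [Category.{v₂} J]

/-- Quasi-isomorphisms between objects with property `P`: the maps inducing an isomorphism on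
the cohomology `H`. -/
def qis : MorphismProperty P.FullSubcategory :=
  (MorphismProperty.isomorphisms 𝒟).inverseImage (P.ι ⋙ H)

/-- The homotopy category of `J`-shaped diagrams of objects with property `P`: objectwise
quasi-isomorphisms are inverted. -/
abbrev HoDiag := ((qis H P).functorCategory J).Localization

/-- The localization functor from diagrams to the homotopy category of diagrams. -/
abbrev toHoDiag : (J ⥤ P.FullSubcategory) ⥤ HoDiag H P J := ((qis H P).functorCategory J).Q

theorem qis_inverted : ((qis H P).functorCategory J).IsInvertedBy
    ((Functor.whiskeringRight J _ _).obj (P.ι ⋙ H)) := by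
  intro F G f hf
  have : ∀ j, IsIso ((((Functor.whiskeringRight J _ _).obj (P.ι ⋙ H)).map f).app j) :=
    fun j => hf j
  exact NatIso.isIso_of_isIso_app _

/-- Cohomology, on the homotopy category of diagrams. -/
def hoCoh : HoDiag H P J ⥤ (J ⥤ 𝒟) :=
  Localization.Construction.lift _ (qis_inverted H P J)

variable {H P J} in
/-- The map induced on the cohomology of the objects at the vertex `j` by a morphism in the
homotopy category of diagrams. -/
def cohAt {F G : J ⥤ P.FullSubcategory} (f : (toHoDiag H P J).obj F ⟶ (toHoDiag H P J).obj G)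
    (j : J) : H.obj (F.obj j).obj ⟶ H.obj (G.obj j).obj :=
  ((hoCoh H P J).map f).app j

theorem cohAt_map {F G : J ⥤ P.FullSubcategory} (f : F ⟶ G) (j : J) :
    cohAt ((toHoDiag H P J).map f) j = H.map (f.app j).hom := by
  have h := Functor.congr_hom (Localization.Construction.fac _ (qis_inverted H P J)) f
  have h' : (hoCoh H P J).map ((toHoDiag H P J).map f) =
      ((Functor.whiskeringRight J _ _).obj (P.ι ⋙ H)).map f :=
    h.trans ((Category.id_comp _).trans (Category.comp_id _))
  exact congrArg (fun g => NatTrans.app g j) h'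

theorem cohAt_comp {F G K : J ⥤ P.FullSubcategory}
    (f : (toHoDiag H P J).obj F ⟶ (toHoDiag H P J).obj G)
    (g : (toHoDiag H P J).obj G ⟶ (toHoDiag H P J).obj K) (j : J) :
    cohAt (f ≫ g) j = cohAt f j ≫ cohAt g j :=
  congrArg (fun a => NatTrans.app a j) ((hoCoh H P J).map_comp f g)

/-- Let `H` be a cohomology functor, `c` the tautological maps `H(X) ⟶ H(H(X))` that identify the
cohomology of the zero-differential object `H(X)` with itself, and `Z` the property of having zero
differential. The objects with property `P` are canonically formal, up to contractible choice, if: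

* `H(X)` has zero differential and property `P`, for `X` with property `P`;
* for every category `J` and every diagram `F : J ⥤ P.FullSubcategory` there is exactly one
  morphism `F ⟶ H ∘ F` in the homotopy category of `J`-diagrams that induces the identity on
  cohomology; it is an isomorphism, natural in `F`. (The one-point category `J` gives the
  formality isomorphisms `X ≅ H(X)`; constant diagrams on arbitrary `J` give the
  contractibility of the choice; the identity diagram gives the coherent naturality in `X`.)
* for every category `J` cohomology exhibits the category of `J`-diagrams of zero-differential
  objects with property `P` as the homotopy category of `J`-diagrams of objects with
  property `P`: the homotopy theory of the latter is that of an ordinary category. -/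
def CanonicallyFormal {𝒟 : Type u₁} [Category.{v₁} 𝒟] (H : 𝒟 ⥤ 𝒟) (c : H ⟶ H ⋙ H)
    (Z P : ObjectProperty 𝒟) : Prop :=
  ∃ hP : ∀ X : P.FullSubcategory, (Z ⊓ P) ((P.ι ⋙ H).obj X),
    ∀ (J : Type u₂) [Category.{v₂} J],
      (∃ α : toHoDiag H P J ≅
          (Functor.whiskeringRight J _ _).obj (P.lift (P.ι ⋙ H) fun X => (hP X).2) ⋙
            toHoDiag H P J,
        ∀ F : J ⥤ P.FullSubcategory,
          (∀ j : J, cohAt (α.hom.app F) j = c.app (F.obj j).obj) ∧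
          ∀ β : (toHoDiag H P J).obj F ⟶
              (toHoDiag H P J).obj (F ⋙ P.lift (P.ι ⋙ H) fun X => (hP X).2),
            (∀ j : J, cohAt β j = c.app (F.obj j).obj) →
              β = α.hom.app F) ∧
      ((Functor.whiskeringRight J _ _).obj ((Z ⊓ P).lift (P.ι ⋙ H) hP)).IsLocalization
        ((qis H P).functorCategory J)

end Formality

end PureFormality
end

noncomputable section

namespace PureFormality

/-! ### Torsion submodules of modules over the Laurent polynomial ring -/

section Torsion

variable {k : Type} [Field k]

/-- The products of factors `t - α` with `α ∈ S`. -/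
def rootMonoid (S : Set kˣ) : Submonoid k[T;T⁻¹] :=
  Submonoid.closure {p | ∃ α ∈ S, p = T 1 - C (α : k)}

theorem rootMonoid_mono {S S' : Set kˣ} (h : S ⊆ S') : rootMonoid S ≤ rootMonoid S' :=
  Submonoid.closure_mono fun _ ⟨α, hα, e⟩ => ⟨α, h hα, e⟩

theorem mem_rootMonoid {S : Set kˣ} {α : kˣ} (h : α ∈ S) :
    (T 1 - C (α : k) : k[T;T⁻¹]) ∈ rootMonoid S :=
  Submonoid.subset_closure ⟨α, h, rfl⟩

/-- For `α ≠ β` the difference of `t - α` and `t - β` is the nonzero constant `β - α`, a unit;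
coprimality then passes to products. The separation of weights rests on this. -/
theorem isCoprime_of_disjoint {S S' : Set kˣ} (h : Disjoint S S') {p q : k[T;T⁻¹]}
    (hp : p ∈ rootMonoid S) (hq : q ∈ rootMonoid S') : IsCoprime p q := by
  induction hp using Submonoid.closure_induction with
  | one => exact isCoprime_one_left
  | mul x y _ _ hx hy => exact hx.mul_left hy
  | mem x hx =>
    obtain ⟨α, hα, rfl⟩ := hx
    induction hq using Submonoid.closure_induction with
    | one => exact isCoprime_one_right
    | mul x y _ _ hx hy => exact hx.mul_right hy
    | mem y hy =>
      obtain ⟨β, hβ, rfl⟩ := hy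
      have hne : (β : k) - α ≠ 0 := fun e =>
        Set.disjoint_left.1 h hα (by rwa [← Units.ext (sub_eq_zero.1 e)])
      refine ⟨C ((β - α : k)⁻¹), -C ((β - α : k)⁻¹), ?_⟩
      have : (C ((β - α : k)⁻¹) : k[T;T⁻¹]) * (C (β : k) - C (α : k)) = 1 := by
        rw [← map_sub, ← map_mul, inv_mul_cancel₀ hne, map_one]
      linear_combination this

variable {M N P : Type*} [AddCommGroup M] [Module k[T;T⁻¹] M] [AddCommGroup N]
  [Module k[T;T⁻¹] N] [AddCommGroup P] [Module k[T;T⁻¹] P]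

variable (M) in
/-- The elements killed by a product of factors `t - α` with `α ∈ S`. -/
def rootTorsion (S : Set kˣ) : Submodule k[T;T⁻¹] M where
  carrier := {x | ∃ p ∈ rootMonoid S, p • x = 0}
  zero_mem' := ⟨1, one_mem _, smul_zero _⟩
  add_mem' := by
    rintro x y ⟨p, hp, hx⟩ ⟨q, hq, hy⟩
    refine ⟨p * q, mul_mem hp hq, ?_⟩
    rw [smul_add, mul_smul p q y, hy, mul_comm, mul_smul, hx, smul_zero, smul_zero, add_zero]
  smul_mem' := by
    rintro r x ⟨p, hp, hx⟩
    exact ⟨p, hp, by rw [smul_comm, hx, smul_zero]⟩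

theorem mem_rootTorsion {S : Set kˣ} {x : M} :
    x ∈ rootTorsion M S ↔ ∃ p ∈ rootMonoid S, p • x = 0 := Iff.rfl

theorem rootTorsion_mono {S S' : Set kˣ} (h : S ⊆ S') : rootTorsion M S ≤ rootTorsion M S' :=
  fun _ ⟨p, hp, hx⟩ => ⟨p, rootMonoid_mono h hp, hx⟩

theorem map_mem_rootTorsion {S : Set kˣ} (f : M →ₗ[k[T;T⁻¹]] N) {x : M}
    (hx : x ∈ rootTorsion M S) : f x ∈ rootTorsion N S := by
  obtain ⟨p, hp, hx⟩ := hx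
  exact ⟨p, hp, by rw [← map_smul, hx, map_zero]⟩

theorem mem_rootTorsion_of_smul_mem {S : Set kˣ} {p : k[T;T⁻¹]} (hp : p ∈ rootMonoid S) {x : M}
    (hx : p • x ∈ rootTorsion M S) : x ∈ rootTorsion M S := by
  obtain ⟨q, hq, hx⟩ := hx
  exact ⟨q * p, mul_mem hq hp, by rw [mul_smul, hx]⟩

theorem eq_zero_of_coprime_smul {p q : k[T;T⁻¹]} (h : IsCoprime p q) {x : M}
    (hp : p • x = 0) (hq : q • x = 0) : x = 0 := by
  obtain ⟨a, b, h⟩ := h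
  rw [← one_smul k[T;T⁻¹] x, ← h, add_smul, mul_smul, mul_smul, hp, hq]
  simp

theorem eq_zero_of_mem_rootTorsion {S S' : Set kˣ} (h : Disjoint S S') {x : M}
    (hx : x ∈ rootTorsion M S) (hx' : x ∈ rootTorsion M S') : x = 0 := by
  obtain ⟨p, hp, hpx⟩ := hx
  obtain ⟨q, hq, hqx⟩ := hx'
  exact eq_zero_of_coprime_smul (isCoprime_of_disjoint h hp hq) hpx hqx

/-- Chinese remainder: split an annihilator as `p * q` with `a p + b q = 1`; then `x = (b q) x + (a
p) x`, where the first term is killed by `p` and the second by `q`. -/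
theorem exists_add_of_mem_rootTorsion {S S' U : Set kˣ} (h : Disjoint S S') (hU : U ⊆ S ∪ S')
    {x : M} (hx : x ∈ rootTorsion M U) :
    ∃ y ∈ rootTorsion M S, ∃ z ∈ rootTorsion M S', y + z = x := by
  obtain ⟨r, hr, hrx⟩ := hx
  have hr' : r ∈ rootMonoid S ⊔ rootMonoid S' := by
    have e : {p : k[T;T⁻¹] | ∃ α ∈ S ∪ S', p = T 1 - C (α : k)} =
        {p | ∃ α ∈ S, p = T 1 - C (α : k)} ∪ {p | ∃ α ∈ S', p = T 1 - C (α : k)} := by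
      ext p
      simp only [Set.mem_union, Set.mem_ofPred_eq, or_and_right, exists_or]
    rw [rootMonoid, rootMonoid, ← Submonoid.closure_union, ← e]
    exact rootMonoid_mono hU hr
  obtain ⟨p, hp, q, hq, rfl⟩ := Submonoid.mem_sup.1 hr'
  obtain ⟨a, b, hab⟩ := isCoprime_of_disjoint h hp hq
  refine ⟨(b * q) • x, ⟨p, hp, ?_⟩, (a * p) • x, ⟨q, hq, ?_⟩, ?_⟩
  · rw [smul_smul, show p * (b * q) = b * (p * q) by ring, mul_smul, hrx, smul_zero]
  · rw [smul_smul, show q * (a * p) = a * (p * q) by ring, mul_smul, hrx, smul_zero]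
  · rw [← add_smul, add_comm, hab, one_smul]

/-- A pairing that is linear over `k` and compatible with `t` multiplies generalized
eigenvalues. -/
theorem pairing_mem_rootTorsion (μ : M →+ N →+ P)
    (hl : ∀ (c : k) x y, μ ((C c : k[T;T⁻¹]) • x) y = (C c : k[T;T⁻¹]) • μ x y)
    (hr : ∀ (c : k) x y, μ x ((C c : k[T;T⁻¹]) • y) = (C c : k[T;T⁻¹]) • μ x y)
    (ht : ∀ x y, μ ((T 1 : k[T;T⁻¹]) • x) ((T 1 : k[T;T⁻¹]) • y) = (T 1 : k[T;T⁻¹]) • μ x y)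
    {S S' U : Set kˣ} (hU : ∀ α ∈ S, ∀ β ∈ S', α * β ∈ U) {x : M} {y : N}
    (hx : x ∈ rootTorsion M S) (hy : y ∈ rootTorsion N S') : μ x y ∈ rootTorsion P U := by
  obtain ⟨p, hp, hx⟩ := hx
  obtain ⟨q, hq, hy⟩ := hy
  induction hp using Submonoid.closure_induction_right generalizing q x y with
  | one => rw [one_smul] at hx; simp [hx]
  | mul_right p' hp' a ha ih =>
    obtain ⟨α, hα, rfl⟩ := ha
    induction hq using Submonoid.closure_induction_right generalizing y with
    | one => rw [one_smul] at hy; simp [hy]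
    | mul_right q' hq' b hb ih' =>
      obtain ⟨β, hβ, rfl⟩ := hb
      refine mem_rootTorsion_of_smul_mem (mem_rootMonoid (hU α hα β hβ)) ?_
      -- Twisted Leibniz rule for `t - αβ`: in each term on the right, one of the two arguments has
      -- an annihilator with one factor fewer, so the nested inductions apply.
      have e : (T 1 - C ((α * β : kˣ) : k) : k[T;T⁻¹]) • μ x y =
          μ ((T 1 - C (α : k) : k[T;T⁻¹]) • x) ((T 1 : k[T;T⁻¹]) • y) +
            (C (α : k) : k[T;T⁻¹]) • μ x ((T 1 - C (β : k) : k[T;T⁻¹]) • y) := by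
        simp only [sub_smul, map_sub, AddMonoidHom.sub_apply, hl, hr, ht, smul_sub, smul_smul,
          Units.val_mul, map_mul]
        abel
      rw [e]
      refine add_mem (ih (by rwa [← mul_smul]) _ (mul_mem hq' (Submonoid.subset_closure
        ⟨β, hβ, rfl⟩)) ?_) (Submodule.smul_mem _ _ (ih' (by rwa [← mul_smul])))
      rw [smul_comm, hy, smul_zero]

/-- An additive map that commutes with scalars of `k` and with `t` is linear over `k[t, t⁻¹]`. -/
def laurentLinear (φ : M →+ N)
    (hC : ∀ (c : k) x, φ ((C c : k[T;T⁻¹]) • x) = (C c : k[T;T⁻¹]) • φ x)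
    (hT : ∀ x, φ ((T 1 : k[T;T⁻¹]) • x) = (T 1 : k[T;T⁻¹]) • φ x) : M →ₗ[k[T;T⁻¹]] N where
  toFun := φ
  map_add' := φ.map_add
  map_smul' r x := by
    have hT' : ∀ x, φ ((T (-1) : k[T;T⁻¹]) • x) = (T (-1) : k[T;T⁻¹]) • φ x := fun x => by
      have h1 : φ x = (T 1 : k[T;T⁻¹]) • φ ((T (-1) : k[T;T⁻¹]) • x) := by
        rw [← hT, smul_smul, ← T_add]; simp
      rw [h1, smul_smul (T (-1)), ← T_add]; simp
    have hTn : ∀ (n : ℤ) x, φ ((T n : k[T;T⁻¹]) • x) = (T n : k[T;T⁻¹]) • φ x := fun n => by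
      induction n using Int.induction_on with
      | zero => simp
      | succ n ih => intro x; rw [T_add, mul_smul, ih, hT, mul_smul]
      | pred n ih => intro x; rw [sub_eq_add_neg, T_add, mul_smul, ih, hT', mul_smul]
    induction r using LaurentPolynomial.induction_on' with
    | add p q hp hq => simp only [add_smul, map_add] at *; rw [hp, hq]
    | C_mul_T n a => simp only [RingHom.id_apply, mul_smul]; rw [hC, hTn]

theorem T_smul_eq_self {x : M} (hx : (T 1 : k[T;T⁻¹]) • x = x) (n : ℤ) :
    (T n : k[T;T⁻¹]) • x = x := by
  induction n using Int.induction_on with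
  | zero => simp
  | succ n ih => rw [T_add, mul_smul, hx, ih]
  | pred n ih =>
    nth_rewrite 1 [← hx]
    rw [smul_smul, ← T_add, sub_add_cancel, ih]

theorem pairing_T_smul (μ : M →+ N →+ P)
    (ht : ∀ x y, μ ((T 1 : k[T;T⁻¹]) • x) ((T 1 : k[T;T⁻¹]) • y) = (T 1 : k[T;T⁻¹]) • μ x y)
    (n : ℤ) (x : M) (y : N) :
    μ ((T n : k[T;T⁻¹]) • x) ((T n : k[T;T⁻¹]) • y) = (T n : k[T;T⁻¹]) • μ x y := by
  have e : (T (-1) * T 1 : k[T;T⁻¹]) = 1 := by rw [← T_add]; simp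
  have e' : (T 1 * T (-1) : k[T;T⁻¹]) = 1 := by rw [← T_add]; simp
  have ht' : ∀ x y,
      μ ((T (-1) : k[T;T⁻¹]) • x) ((T (-1) : k[T;T⁻¹]) • y) = (T (-1) : k[T;T⁻¹]) • μ x y :=
    fun x y => by
      rw [← one_smul k[T;T⁻¹] (μ (_ • x) _), ← e, mul_smul, ← ht, smul_smul, smul_smul, e',
        one_smul, one_smul]
  induction n using Int.induction_on generalizing x y with
  | zero => simp
  | succ n ih => rw [T_add, mul_smul, mul_smul, mul_smul, ih, ht]
  | pred n ih => rw [sub_eq_add_neg, T_add, mul_smul, mul_smul, mul_smul, ih, ht']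

end Torsion

/-! ### Sequences in a module, with `t` acting by translation -/

/-- Functions `ℤ → M`. -/
def Seq (M : Type*) : Type _ := ℤ → M

namespace Seq

/-- The sequence with given values. -/
def mk {M : Type*} (f : ℤ → M) : Seq M := f

@[simp] theorem mk_apply {M : Type*} (f : ℤ → M) (n : ℤ) : mk f n = f n := rfl

@[ext] theorem ext {M : Type*} {f g : Seq M} (h : ∀ n, f n = g n) : f = g := funext h

variable {k : Type} [Field k] {M N P : Type*} [AddCommGroup M] [Module k[T;T⁻¹] M]
  [AddCommGroup N] [Module k[T;T⁻¹] N] [AddCommGroup P] [Module k[T;T⁻¹] P]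

instance : AddCommGroup (Seq M) := inferInstanceAs (AddCommGroup (ℤ → M))

variable (M) in
/-- Translation of sequences. -/
def translate : Multiplicative ℤ →* AddMonoid.End (Seq M) where
  toFun m := { toFun := fun g n => g (n - m.toAdd), map_zero' := rfl, map_add' := fun _ _ => rfl }
  map_one' := by ext g : 1; funext n; exact congrArg g (sub_zero n)
  map_mul' a b := by
    ext g : 1; funext n
    exact congrArg g (by rw [toAdd_mul]; ring)

variable (k M) in
/-- Pointwise multiplication by scalars. -/
def pointwise : k →+* AddMonoid.End (Seq M) where
  toFun c :=
    { toFun := fun g n => (C c : k[T;T⁻¹]) • g n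
      map_zero' := funext fun _ => smul_zero _
      map_add' := fun _ _ => funext fun _ => smul_add _ _ _ }
  map_one' := by ext g : 1; funext n; change (C 1 : k[T;T⁻¹]) • g n = g n; simp
  map_mul' a b := by
    ext g : 1; funext n
    change (C (a * b) : k[T;T⁻¹]) • g n = (C a : k[T;T⁻¹]) • (C b : k[T;T⁻¹]) • g n
    rw [map_mul, mul_smul]
  map_zero' := by ext g : 1; funext n; change (C 0 : k[T;T⁻¹]) • g n = 0; simp
  map_add' a b := by
    ext g : 1; funext n
    change (C (a + b) : k[T;T⁻¹]) • g n = (C a : k[T;T⁻¹]) • g n + (C b : k[T;T⁻¹]) • g n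
    rw [map_add, add_smul]

theorem commute_pointwise_translate (c : k) (m : Multiplicative ℤ) :
    Commute (pointwise k M c) (translate M m) := rfl

/-- Constants act pointwise and `t` acts by translation alone; the action of `t` on `M` returns only
through `diff` and `orbit`. -/
instance : Module k[T;T⁻¹] (Seq M) :=
  Module.compHom (Seq M)
    (AddMonoidAlgebra.liftNCRingHom (pointwise k M) (translate M) commute_pointwise_translate)

theorem single_smul (c : k) (m : ℤ) (g : Seq M) (n : ℤ) :
    ((AddMonoidAlgebra.single m c : k[T;T⁻¹]) • g) n = (C c : k[T;T⁻¹]) • g (n - m) := by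
  change (AddMonoidAlgebra.liftNCRingHom (pointwise k M) (translate M) commute_pointwise_translate
    (AddMonoidAlgebra.single m c)) g n = _
  rw [AddMonoidAlgebra.liftNCRingHom_single]
  rfl

@[simp] theorem C_smul (c : k) (g : Seq M) (n : ℤ) :
    ((C c : k[T;T⁻¹]) • g) n = (C c : k[T;T⁻¹]) • g n := by
  have := single_smul c 0 g n
  rwa [sub_zero] at this

@[simp] theorem T_smul (m : ℤ) (g : Seq M) (n : ℤ) :
    ((T m : k[T;T⁻¹]) • g) n = g (n - m) := by
  refine (single_smul 1 m g n).trans ?_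
  rw [map_one, one_smul]

@[simp] theorem add_apply (f g : Seq M) (n : ℤ) : (f + g) n = f n + g n := rfl
@[simp] theorem sub_apply (f g : Seq M) (n : ℤ) : (f - g) n = f n - g n := rfl
@[simp] theorem zero_apply (n : ℤ) : (0 : Seq M) n = 0 := rfl

/-- The map of sequences induced by a linear map. -/
def map (φ : M →ₗ[k[T;T⁻¹]] N) : Seq M →ₗ[k[T;T⁻¹]] Seq N :=
  laurentLinear
    { toFun := fun f n => φ (f n)
      map_zero' := funext fun _ => map_zero φ
      map_add' := fun _ _ => funext fun _ => map_add φ _ _ }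
    (fun c f => by
      ext n
      change φ (((C c : k[T;T⁻¹]) • f) n) = ((C c : k[T;T⁻¹]) • mk fun n => φ (f n) : Seq N) n
      simp)
    (fun f => by
      ext n
      change φ (((T 1 : k[T;T⁻¹]) • f) n) = ((T 1 : k[T;T⁻¹]) • mk fun n => φ (f n) : Seq N) n
      simp)

@[simp] theorem map_apply (φ : M →ₗ[k[T;T⁻¹]] N) (f : Seq M) (n : ℤ) : map φ f n = φ (f n) := rfl

variable (k M) in
/-- The twisted difference operator `f ↦ (n ↦ t f(n + 1) - f(n))`. -/
def diff : Seq M →ₗ[k[T;T⁻¹]] Seq M :=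
  laurentLinear
    { toFun := fun f n => (T 1 : k[T;T⁻¹]) • f (n + 1) - f n
      map_zero' := funext fun n => by simp
      map_add' := fun f g => funext fun n => by
        simp only [add_apply, smul_add]
        exact add_sub_add_comm _ _ _ _ }
    (fun c f => by
      ext n
      change (T 1 : k[T;T⁻¹]) • ((C c : k[T;T⁻¹]) • f) (n + 1) - ((C c : k[T;T⁻¹]) • f) n =
        ((C c : k[T;T⁻¹]) • mk fun n => (T 1 : k[T;T⁻¹]) • f (n + 1) - f n : Seq M) n
      rw [C_smul, C_smul, C_smul, mk_apply, smul_sub, smul_comm])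
    (fun f => by
      ext n
      change (T 1 : k[T;T⁻¹]) • ((T 1 : k[T;T⁻¹]) • f) (n + 1) - ((T 1 : k[T;T⁻¹]) • f) n =
        ((T 1 : k[T;T⁻¹]) • mk fun n => (T 1 : k[T;T⁻¹]) • f (n + 1) - f n : Seq M) n
      simp)

@[simp] theorem diff_apply (f : Seq M) (n : ℤ) :
    diff k M f n = (T 1 : k[T;T⁻¹]) • f (n + 1) - f n := rfl

variable (k M) in
/-- The sequences `n ↦ t⁻ⁿ x`. -/
def orbit : M →ₗ[k[T;T⁻¹]] Seq M :=
  laurentLinear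
    { toFun := fun x n => (T (-n) : k[T;T⁻¹]) • x
      map_zero' := funext fun n => by simp
      map_add' := fun f g => funext fun n => smul_add _ _ _ }
    (fun c x => by
      ext n
      change (T (-n) : k[T;T⁻¹]) • (C c : k[T;T⁻¹]) • x =
        ((C c : k[T;T⁻¹]) • mk fun n => (T (-n) : k[T;T⁻¹]) • x : Seq M) n
      rw [C_smul, mk_apply, smul_comm])
    (fun x => by
      ext n
      change (T (-n) : k[T;T⁻¹]) • (T 1 : k[T;T⁻¹]) • x =
        ((T 1 : k[T;T⁻¹]) • mk fun n => (T (-n) : k[T;T⁻¹]) • x : Seq M) n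
      rw [T_smul, mk_apply, smul_smul, ← T_add]
      congr 2; ring)

@[simp] theorem orbit_apply (x : M) (n : ℤ) : orbit k M x n = (T (-n) : k[T;T⁻¹]) • x := rfl

@[simp] theorem diff_orbit (x : M) : diff k M (orbit k M x) = 0 := by
  ext n
  rw [diff_apply, orbit_apply, orbit_apply, smul_smul, ← T_add, zero_apply, sub_eq_zero]
  congr 2; ring

/-- Start from `g 0 = 0` and run the recursion forwards with `φ` and backwards with its inverse. -/
theorem exists_recursion {A : Type*} [AddCommGroup A] (φ : A ≃+ A) (h : ℤ → A) :
    ∃ g : Seq A, ∀ n, g (n + 1) = φ (g n) + h n := by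
  let up : ℕ → A := fun n => Nat.rec 0 (fun m x => φ x + h m) n
  -- `down n` is the value at `-(n + 1)`, matching `Int.negSucc n`.
  let down : ℕ → A := fun n => Nat.rec (φ.symm (0 - h (-1)))
    (fun m x => φ.symm (x - h (-(m + 1 : ℕ) - 1))) n
  refine ⟨fun n => Int.rec up down n, fun n => ?_⟩
  obtain (n | n) := n
  · rfl
  · obtain (_ | n) := n
    · change (0 : A) = φ (φ.symm (0 - h (-1))) + h (-1)
      simp
    · change down n = φ (φ.symm (down n - h (-(n + 1 : ℕ) - 1))) + h (Int.negSucc (n + 1))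
      rw [AddEquiv.apply_symm_apply, show (-(n + 1 : ℕ) - 1 : ℤ) = Int.negSucc (n + 1) by
        rw [Int.negSucc_eq]; push_cast; ring, sub_add_cancel]

/-- Multiplication by a unit of the Laurent polynomial ring, as an additive automorphism. -/
def smulEquiv (u : k[T;T⁻¹]ˣ) : M ≃+ M := DistribMulAction.toAddEquiv M u

theorem smulEquiv_apply (u : k[T;T⁻¹]ˣ) (x : M) : smulEquiv u x = (u : k[T;T⁻¹]) • x := rfl

variable (k) in
/-- `t` as a unit. -/
def tUnit : k[T;T⁻¹]ˣ where
  val := T 1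
  inv := T (-1)
  val_inv := by rw [← T_add]; simp
  inv_val := by rw [← T_add]; simp

/-- Since `t` is invertible on `M`, the equation is the recursion `g (n + 1) = t⁻¹ g n + t⁻¹ h n`.
Together with the description of the kernel by orbits, this gives the exact sequence `0 → M → Seq M
→ Seq M → 0`. -/
theorem diff_surjective : Function.Surjective (diff k M) := by
  intro h
  obtain ⟨g, hg⟩ := exists_recursion (smulEquiv (M := M) (tUnit k)⁻¹)
    (fun n => (T (-1) : k[T;T⁻¹]) • h n)
  refine ⟨g, ?_⟩
  ext n
  have e : (T 1 : k[T;T⁻¹]) * T (-1) = 1 := by rw [← T_add]; simp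
  rw [diff_apply, hg, smulEquiv_apply, smul_add, smul_smul, smul_smul, e]
  change (T 1 * T (-1) : k[T;T⁻¹]) • g n + _ - _ = _
  rw [e, one_smul, one_smul, add_sub_cancel_left]

theorem eq_orbit_of_diff_eq_zero {f : Seq M} (hf : diff k M f = 0) : f = orbit k M (f 0) := by
  have h : ∀ n, f n = (T 1 : k[T;T⁻¹]) • f (n + 1) := fun n =>
    (sub_eq_zero.1 (congrFun hf n)).symm
  ext n
  rw [orbit_apply]
  induction n using Int.induction_on with
  | zero => simp
  | succ n ih =>
    rw [h n] at ih
    have := congrArg ((T (-1) : k[T;T⁻¹]) • ·) ih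
    simp only [smul_smul, ← T_add] at this
    simpa [neg_add_rev, add_comm] using this
  | pred n ih =>
    rw [h, sub_add_cancel, ih, smul_smul, ← T_add]
    congr 2; ring

/-- For one factor the equation reads `g (n - 1) - α g n = h n`, a recursion solvable in both
directions because `α` is a unit. This divisibility is the reason for passing to sequences. -/
theorem exists_smul_eq {S : Set kˣ} {p : k[T;T⁻¹]} (hp : p ∈ rootMonoid S) (h : Seq M) :
    ∃ g : Seq M, p • g = h := by
  induction hp using Submonoid.closure_induction generalizing h with
  | one => exact ⟨h, one_smul _ _⟩
  | mul x y _ _ hx hy =>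
    obtain ⟨g, rfl⟩ := hx h
    obtain ⟨g, rfl⟩ := hy g
    exact ⟨g, mul_smul _ _ _⟩
  | mem x hx =>
    obtain ⟨α, -, rfl⟩ := hx
    let u : k[T;T⁻¹]ˣ := Units.map (C : k →+* k[T;T⁻¹]).toMonoidHom α
    obtain ⟨g, hg⟩ := exists_recursion (smulEquiv (M := M) u⁻¹)
      (fun n => -((u⁻¹ : k[T;T⁻¹]ˣ) : k[T;T⁻¹]) • h (n + 1))
    have e : (C (α : k) : k[T;T⁻¹]) * ((u⁻¹ : k[T;T⁻¹]ˣ) : k[T;T⁻¹]) = 1 := u.mul_inv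
    refine ⟨g, ?_⟩
    ext n
    have := hg (n - 1)
    rw [sub_add_cancel, smulEquiv_apply] at this
    rw [sub_smul, sub_apply, T_smul, C_smul, this, neg_smul, smul_add, smul_neg, smul_smul,
      smul_smul, e, one_smul, one_smul]
    abel

end Seq

/-! ### Derived translation-invariants of the complex of sequences -/

section Transport

variable {k : Type} [Field k]

/-- The identification of the terms of a complex in equal degrees. -/
def transport (K : Cpx k) {i j : ℤ} (h : i = j) : K.X i →ₗ[k[T;T⁻¹]] K.X j :=
  (K.XIsoOfEq h).hom.hom

variable {K L M : Cpx k}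

@[simp] theorem transport_rfl {i : ℤ} (x : K.X i) : transport K rfl x = x := by
  simp [transport]

@[simp] theorem transport_eq_zero_iff {i j : ℤ} (h : i = j) {x : K.X i} :
    transport K h x = 0 ↔ x = 0 := by
  subst h; rw [transport_rfl]

@[simp] theorem d_transport {i j n : ℤ} (h : i = j) (x : K.X i) :
    (K.d j n).hom (transport K h x) = (K.d i n).hom x := by
  subst h; rw [transport_rfl]

@[simp] theorem transport_d {i j n : ℤ} (h : i = j) (x : K.X n) :
    transport K h ((K.d n i).hom x) = (K.d n j).hom x := by
  subst h; rw [transport_rfl]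

@[simp] theorem hom_transport (f : K ⟶ L) {i j : ℤ} (h : i = j) (x : K.X i) :
    (f.f j).hom (transport K h x) = transport L h ((f.f i).hom x) := by
  subst h; simp

namespace Pairing

variable (μ : Pairing K L M)

theorem app_transport_left {i i' j n n' : ℤ} (h : i = i') (h' : i' + j = n') (hn : i + j = n)
    (x : K.X i) (y : L.X j) :
    μ.app i' j n' h' (transport K h x) y =
      transport M (by omega : n = n') (μ.app i j n hn x y) := by
  subst h; obtain rfl : n = n' := by omega
  simp

theorem app_transport_right {i j j' n n' : ℤ} (h : j = j') (h' : i + j' = n') (hn : i + j = n)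
    (x : K.X i) (y : L.X j) :
    μ.app i j' n' h' x (transport L h y) =
      transport M (by omega : n = n') (μ.app i j n hn x y) := by
  subst h; obtain rfl : n = n' := by omega
  simp

end Pairing

end Transport

/-! ### The complex of cochains on the real line -/

section Path

variable {k : Type} [Field k]

theorem Seq.units_smul_apply {M : Type*} [AddCommGroup M] (z : ℤˣ) (f : Seq M) (n : ℤ) :
    (z • f) n = z • f n := rfl

theorem units_smul_smul {M : Type*} [AddCommGroup M] [Module k[T;T⁻¹] M] (z : ℤˣ) (r : k[T;T⁻¹])
    (x : M) : z • r • x = r • z • x := smul_comm _ _ _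

/-- The differential `(f, h) ↦ (d f, δ f - d h)` of the complex `pathCpx`, where `δ` is the twisted
difference operator. -/
def pathD (K : Cpx k) (i j : ℤ) (h : i + 1 = j) :
    (Seq (K.X i) × Seq (K.X (i - 1))) →ₗ[k[T;T⁻¹]] (Seq (K.X j) × Seq (K.X (j - 1))) :=
  ((Seq.map (K.d i j).hom).comp (LinearMap.fst _ _ _)).prod
    (((Seq.map (transport K (by omega : i = j - 1))).comp
        ((Seq.diff k _).comp (LinearMap.fst _ _ _))) -
      (Seq.map (K.d (i - 1) (j - 1)).hom).comp (LinearMap.snd _ _ _))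

/-- The complex of pairs of sequences `(f, h)` with values in `K^n` and `K^{n-1}`: the cochains
on the real line with values in `K`, cellular for the integer points. -/
def pathCpx (K : Cpx k) : Cpx k where
  X n := ModuleCat.of _ (Seq (K.X n) × Seq (K.X (n - 1)))
  d i j := if h : i + 1 = j then ModuleCat.ofHom (pathD K i j h) else 0
  shape i j h := dif_neg h
  d_comp_d' i j l hij hjl := by
    replace hij : i + 1 = j := hij
    replace hjl : j + 1 = l := hjl
    rw [dif_pos hij, dif_pos hjl, ← ModuleCat.ofHom_comp]
    refine congrArg ModuleCat.ofHom (LinearMap.ext fun x => Prod.ext ?_ ?_) <;> ext n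
    · simp [pathD, d_d]
    · simp [pathD, d_d]

namespace pathCpx

variable {K L M : Cpx k}

/-- The element of `pathCpx K` with given components. -/
def mk {n : ℤ} (f : Seq (K.X n)) (h : Seq (K.X (n - 1))) : (pathCpx K).X n := (f, h)

/-- The first component. -/
def fst {n : ℤ} : (pathCpx K).X n →ₗ[k[T;T⁻¹]] Seq (K.X n) := LinearMap.fst _ _ _

/-- The second component. -/
def snd {n : ℤ} : (pathCpx K).X n →ₗ[k[T;T⁻¹]] Seq (K.X (n - 1)) := LinearMap.snd _ _ _

@[simp] theorem fst_mk {n : ℤ} (f : Seq (K.X n)) (h : Seq (K.X (n - 1))) :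
    fst (mk f h) = f := rfl

@[simp] theorem snd_mk {n : ℤ} (f : Seq (K.X n)) (h : Seq (K.X (n - 1))) :
    snd (mk f h) = h := rfl

theorem ext {n : ℤ} {x y : (pathCpx K).X n} (h₁ : ∀ m, fst x m = fst y m)
    (h₂ : ∀ m, snd x m = snd y m) : x = y :=
  Prod.ext (Seq.ext h₁) (Seq.ext h₂)

theorem d_eq {i j : ℤ} (h : i + 1 = j) (x : (pathCpx K).X i) :
    ((pathCpx K).d i j).hom x = pathD K i j h x := by
  simp only [pathCpx, dif_pos h]
  rfl

@[simp] theorem fst_d {i j : ℤ} (h : i + 1 = j) (x : (pathCpx K).X i) (m : ℤ) :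
    fst (((pathCpx K).d i j).hom x) m = (K.d i j).hom (fst x m) := by
  rw [d_eq h]; rfl

@[simp] theorem snd_d {i j : ℤ} (h : i + 1 = j) (x : (pathCpx K).X i) (m : ℤ) :
    snd (((pathCpx K).d i j).hom x) m =
      transport K (by omega : i = j - 1) ((T 1 : k[T;T⁻¹]) • fst x (m + 1) - fst x m)
        - (K.d (i - 1) (j - 1)).hom (snd x m) := by
  rw [d_eq h]; rfl

/-- The map of path complexes induced by a map of complexes. -/
def map (φ : K ⟶ L) : pathCpx K ⟶ pathCpx L where
  f n := ModuleCat.ofHom (LinearMap.prodMap (Seq.map (φ.f n).hom) (Seq.map (φ.f (n - 1)).hom))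
  comm' i j h := by
    ext x
    change ((pathCpx L).d i j).hom (mk (Seq.map (φ.f i).hom (fst x)) (Seq.map _ (snd x))) =
      mk (Seq.map (φ.f j).hom (fst (((pathCpx K).d i j).hom x)))
        (Seq.map (φ.f (j - 1)).hom (snd (((pathCpx K).d i j).hom x)))
    refine ext (fun m => ?_) (fun m => ?_)
    · rw [fst_d h, fst_mk, fst_mk, Seq.map_apply, Seq.map_apply, fst_d h, hom_d]
    · rw [snd_d h, fst_mk, snd_mk, snd_mk, Seq.map_apply, Seq.map_apply, Seq.map_apply,
        Seq.map_apply, snd_d h, hom_d]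
      simp

@[simp] theorem fst_map (φ : K ⟶ L) {n : ℤ} (x : (pathCpx K).X n) (m : ℤ) :
    fst (((map φ).f n).hom x) m = (φ.f n).hom (fst x m) := rfl

@[simp] theorem snd_map (φ : K ⟶ L) {n : ℤ} (x : (pathCpx K).X n) (m : ℤ) :
    snd (((map φ).f n).hom x) m = (φ.f (n - 1)).hom (snd x m) := rfl

theorem map_id : map (𝟙 K) = 𝟙 (pathCpx K) := by
  ext n x
  exact ext (fun _ => rfl) (fun _ => rfl)

theorem map_comp (φ : K ⟶ L) (ψ : L ⟶ M) : map (φ ≫ ψ) = map φ ≫ map ψ := by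
  ext n x
  exact ext (fun _ => rfl) (fun _ => rfl)

variable (K) in
/-- The inclusion of the translation-invariant sequences, a quasi-isomorphism. -/
def incl : K ⟶ pathCpx K where
  f n := ModuleCat.ofHom (LinearMap.prod (Seq.orbit k _) 0)
  comm' i j h := by
    ext x
    change ((pathCpx K).d i j).hom (mk (Seq.orbit k _ x) 0) = mk (Seq.orbit k _ ((K.d i j).hom x)) 0
    refine ext (fun m => ?_) (fun m => ?_)
    · rw [fst_d h, fst_mk, fst_mk, Seq.orbit_apply, Seq.orbit_apply, map_smul]
    · rw [snd_d h, fst_mk, snd_mk, snd_mk, ← Seq.diff_apply, Seq.diff_orbit]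
      simp

@[simp] theorem fst_incl {n : ℤ} (x : K.X n) (m : ℤ) :
    fst (((incl K).f n).hom x) m = (T (-m) : k[T;T⁻¹]) • x := rfl

@[simp] theorem snd_incl {n : ℤ} (x : K.X n) (m : ℤ) :
    snd (((incl K).f n).hom x) m = 0 := rfl

theorem incl_naturality (φ : K ⟶ L) : φ ≫ incl L = incl K ≫ map φ := by
  ext n x
  refine ext (fun m => ?_) (fun m => ?_)
  · change (T (-m) : k[T;T⁻¹]) • (φ.f n).hom x = (φ.f n).hom ((T (-m) : k[T;T⁻¹]) • x)
    rw [map_smul]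
  · change (0 : L.X (n - 1)) = (φ.f (n - 1)).hom 0
    rw [map_zero]

/-- The path complex is the shifted cone of `diff`, which is surjective with kernel the orbits, that
is, a copy of `K`. -/
theorem cohMap_incl_bijective (i : ℤ) : Function.Bijective (cohMap (incl K) i) := by
  constructor
  · refine (injective_iff_map_eq_zero _).2 fun c hc => ?_
    obtain ⟨x, hx, rfl⟩ := exists_cls c
    have hc' : cls (((incl K).f i).hom x) _ = cls (0 : (pathCpx K).X i) (map_zero _) := hc
    obtain ⟨z, hz⟩ := (cls_eq_iff (show i - 1 + 1 = i by omega) _ _).1 hc'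
    refine (cls_eq_iff (show i - 1 + 1 = i by omega) hx (map_zero _)).2 ⟨fst z 0, ?_⟩
    -- Evaluating first components at the vertex `0` commutes with the differentials and sends the
    -- orbit of `x` back to `x`.
    rw [← fst_d (by omega), hz, sub_zero, fst_incl]
    simp
  · intro c
    obtain ⟨x, hx, rfl⟩ := exists_cls c
    -- Subtracting the coboundary of `(g, 0)` kills the second component. The cocycle condition then
    -- puts the first component in the kernel of `diff`, so it is an orbit.
    obtain ⟨g, hg⟩ := Seq.diff_surjective (k := k) (snd x)
    have hz : (x - ((pathCpx K).d (i - 1) i).hom (mk g 0)) =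
        ((incl K).f i).hom (fst (x - ((pathCpx K).d (i - 1) i).hom (mk g 0)) 0) := by
      have h2 : ∀ m, snd (x - ((pathCpx K).d (i - 1) i).hom (mk g 0)) m = 0 := fun m => by
        rw [map_sub, Seq.sub_apply, snd_d (by omega), snd_mk, fst_mk, ← hg, Seq.diff_apply]
        simp
      refine ext (fun m => ?_) h2
      rw [fst_incl, ← Seq.orbit_apply (k := k)]
      refine congrFun (Seq.eq_orbit_of_diff_eq_zero ?_) m
      have hd : ((pathCpx K).d i (i + 1)).hom (x - ((pathCpx K).d (i - 1) i).hom (mk g 0)) = 0 := by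
        rw [map_sub, hx, d_d, sub_zero]
      ext m
      have := snd_d rfl (x - ((pathCpx K).d (i - 1) i).hom (mk g 0)) m
      rw [hd, h2, map_zero, map_zero, sub_zero, Seq.zero_apply] at this
      exact (transport_eq_zero_iff _).1 this.symm
    have hd : (K.d i (i + 1)).hom (fst (x - ((pathCpx K).d (i - 1) i).hom (mk g 0)) 0) = 0 := by
      rw [← fst_d rfl, map_sub, hx, d_d, sub_zero, map_zero, Seq.zero_apply]
    refine ⟨cls _ hd, ?_⟩
    rw [cohMap_cls]
    refine (cls_eq_iff (show i - 1 + 1 = i by omega) _ _).2 ⟨-(mk g 0), ?_⟩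
    rw [← hz, map_neg]
    abel

theorem exists_smul_eq {S : Set kˣ} {p : k[T;T⁻¹]} (hp : p ∈ rootMonoid S) {n : ℤ}
    (x : (pathCpx K).X n) : ∃ y, p • y = x := by
  obtain ⟨f, hf⟩ := Seq.exists_smul_eq hp (fst x)
  obtain ⟨h, hh⟩ := Seq.exists_smul_eq hp (snd x)
  exact ⟨mk f h, Prod.ext hf hh⟩

end pathCpx

/-! ### Cup products of cochains on the real line -/

namespace Pairing

open pathCpx

variable {K L M : Cpx k} (μ : Pairing K L M)

/-- The product `(f, h) (g, g') = (f g, h ⋆ g ± f g')` with `(h ⋆ g)(m) = h(m) t g(m + 1)`. -/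
def pathFun (i j n : ℤ) (h : i + j = n) (x : (pathCpx K).X i) (y : (pathCpx L).X j) :
    (pathCpx M).X n :=
  pathCpx.mk (Seq.mk fun m => μ.app i j n h (fst x m) (fst y m))
    (Seq.mk fun m =>
      -- Cup product on the edge from `m` to `m + 1`: the left factor is evaluated at the initial
      -- vertex and the right factor at the terminal one, whose value is carried back to `m` by `t`.
      μ.app (i - 1) j (n - 1) (by omega) (snd x m) ((T 1 : k[T;T⁻¹]) • fst y (m + 1)) +
        i.negOnePow • μ.app i (j - 1) (n - 1) (by omega) (fst x m) (snd y m))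

/-- The pairing of path complexes induced by a pairing. -/
def path : Pairing (pathCpx K) (pathCpx L) (pathCpx M) where
  app i j n h := AddMonoidHom.mk'
    (fun x => AddMonoidHom.mk' (μ.pathFun i j n h x) fun y y' => by
      refine pathCpx.ext (fun m => ?_) (fun m => ?_)
      · simp [pathFun]
      · simp [pathFun]; abel)
    fun x x' => by
      refine AddMonoidHom.ext fun y => pathCpx.ext (fun m => ?_) (fun m => ?_)
      · simp [pathFun]
      · simp [pathFun]; abel
  smul_left i j n h c x y := by
    refine pathCpx.ext (fun m => ?_) (fun m => ?_)
    · simp [pathFun, μ.smul_left]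
    · simp [pathFun, μ.smul_left, units_smul_smul]
  smul_right i j n h c x y := by
    refine pathCpx.ext (fun m => ?_) (fun m => ?_)
    · simp [pathFun, μ.smul_right]
    · simp [pathFun, μ.smul_right, units_smul_smul, smul_comm (T 1 : k[T;T⁻¹]) (C c)]
  t_smul i j n h x y := by
    refine pathCpx.ext (fun m => ?_) (fun m => ?_)
    · simp [pathFun]
    · simp [pathFun]
  leibniz i j n h x y := by
    refine pathCpx.ext (fun m => ?_) (fun m => ?_)
    · simp [pathFun, μ.leibniz, Seq.units_smul_apply]
    · have e₁ := μ.leibniz' (i := i - 1) (i' := i + 1 - 1) (j' := j + 1) (n := n - 1)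
        (n' := n + 1 - 1) (by omega) rfl (by omega) (by omega) (snd x m)
        ((T 1 : k[T;T⁻¹]) • fst y (m + 1))
      have e₂ := μ.leibniz' (i := i) (i' := i + 1) (j := j - 1) (j' := j + 1 - 1) (n := n - 1)
        (n' := n + 1 - 1) rfl (by omega) (by omega) (by omega) (fst x m) (snd y m)
      simp only [map_smul] at e₁ e₂
      simp [pathFun, Seq.units_smul_apply, e₁, e₂,
        μ.app_transport_left _ _ h, μ.app_transport_right _ _ h, Int.negOnePow_sub,
        Int.negOnePow_add, smul_smul]
      rw [← map_smul (transport K _), ← map_smul (transport L _), μ.app_transport_left _ _ h,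
        μ.app_transport_right _ _ h, μ.t_smul, map_smul (transport M _)]
      abel

@[simp] theorem fst_path_app {i j n : ℤ} (h : i + j = n) (x : (pathCpx K).X i)
    (y : (pathCpx L).X j) (m : ℤ) :
    fst (μ.path.app i j n h x y) m = μ.app i j n h (fst x m) (fst y m) := rfl

@[simp] theorem snd_path_app {i j n : ℤ} (h : i + j = n) (x : (pathCpx K).X i)
    (y : (pathCpx L).X j) (m : ℤ) :
    snd (μ.path.app i j n h x y) m =
      μ.app (i - 1) j (n - 1) (by omega) (snd x m) ((T 1 : k[T;T⁻¹]) • fst y (m + 1)) +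
        i.negOnePow • μ.app i (j - 1) (n - 1) (by omega) (fst x m) (snd y m) := rfl

/-- Associativity `(x y) z = x (y z)` of four pairings. -/
def Assoc {A B AB X BX Y : Cpx k} (a : Pairing A B AB) (b : Pairing AB X Y)
    (c : Pairing B X BX) (d : Pairing A BX Y) : Prop :=
  ∀ (i j l ij jl n : ℤ) (h₁ : i + j = ij) (h₂ : j + l = jl) (h₃ : ij + l = n)
    (h₄ : i + jl = n) (x : A.X i) (y : B.X j) (z : X.X l),
    b.app ij l n h₃ (a.app i j ij h₁ x y) z = d.app i jl n h₄ x (c.app j l jl h₂ y z)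

/-- The cellular cup product is strictly associative: on an edge, the three terms are indexed by
which factor is evaluated on the edge and match one by one. Allowing four pairings covers
multiplications and actions at once. -/
theorem Assoc.path {A B AB X BX Y : Cpx k} {a : Pairing A B AB} {b : Pairing AB X Y}
    {c : Pairing B X BX} {d : Pairing A BX Y} (H : Assoc a b c d) :
    Assoc a.path b.path c.path d.path := by
  intro i j l ij jl n h₁ h₂ h₃ h₄ x y z
  refine pathCpx.ext (fun m => ?_) (fun m => ?_)
  · simp [H i j l ij jl n h₁ h₂ h₃ h₄]
  · simp only [snd_path_app, fst_path_app, map_add, AddMonoidHom.add_apply, ← c.t_smul]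
    rw [H (i - 1) j l (ij - 1) jl (n - 1) (by omega) h₂ (by omega) (by omega),
      H i j (l - 1) ij (jl - 1) (n - 1) h₁ (by omega) (by omega) (by omega)]
    have e : b.app (ij - 1) l (n - 1) (by omega)
        (i.negOnePow • a.app i (j - 1) (ij - 1) (by omega) (fst x m) (snd y m))
        ((T 1 : k[T;T⁻¹]) • fst z (m + 1)) =
        i.negOnePow • d.app i (jl - 1) (n - 1) (by omega) (fst x m)
          (c.app (j - 1) l (jl - 1) (by omega) (snd y m) ((T 1 : k[T;T⁻¹]) • fst z (m + 1))) := by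
      rw [← H i (j - 1) l (ij - 1) (jl - 1) (n - 1) (by omega) (by omega) (by omega) (by omega),
        Units.smul_def, map_zsmul, Units.smul_def]
      rfl
    have e' : d.app i (jl - 1) (n - 1) (by omega) (fst x m)
        (j.negOnePow • c.app j (l - 1) (jl - 1) (by omega) (fst y m) (snd z m)) =
        j.negOnePow • d.app i (jl - 1) (n - 1) (by omega) (fst x m)
          (c.app j (l - 1) (jl - 1) (by omega) (fst y m) (snd z m)) := by
      rw [Units.smul_def, map_zsmul, Units.smul_def]
    have hs : ij.negOnePow = i.negOnePow * j.negOnePow := by rw [← h₁, Int.negOnePow_add]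
    rw [e, e', hs, smul_add, smul_smul, add_assoc]

theorem path_app_map {K' L' M' : Cpx k} {μ : Pairing K L M} {ν : Pairing K' L' M'} {φ : K ⟶ K'}
    {ψ : L ⟶ L'} {χ : M ⟶ M'} (H : ∀ (i j n : ℤ) (h : i + j = n) (x : K.X i) (y : L.X j),
      (χ.f n).hom (μ.app i j n h x y) = ν.app i j n h ((φ.f i).hom x) ((ψ.f j).hom y))
    (i j n : ℤ) (h : i + j = n) (x : (pathCpx K).X i) (y : (pathCpx L).X j) :
    ((pathCpx.map χ).f n).hom (μ.path.app i j n h x y) =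
      ν.path.app i j n h (((pathCpx.map φ).f i).hom x) (((pathCpx.map ψ).f j).hom y) := by
  refine pathCpx.ext (fun m => ?_) (fun m => ?_)
  · simp [H]
  · simp [H]

theorem path_app_incl (i j n : ℤ) (h : i + j = n) (x : K.X i) (y : L.X j) :
    ((incl M).f n).hom (μ.app i j n h x y) =
      μ.path.app i j n h (((incl K).f i).hom x) (((incl L).f j).hom y) := by
  refine pathCpx.ext (fun m => ?_) (fun m => ?_)
  · simp only [fst_incl, fst_path_app]
    exact (pairing_T_smul _ (μ.t_smul i j n h) _ _ _).symm
  · simp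

/-- A unit fixed by `t` has a constant orbit, so multiplying by it is a pointwise statement with no
edge term. -/
theorem path_one_left {μ : Pairing K L L} {o : ℤ} (ho : o = 0) {e : K.X o}
    (he : (T 1 : k[T;T⁻¹]) • e = e) (H : ∀ (i : ℤ) (x : L.X i), μ.app o i i (by omega) e x = x)
    (i : ℤ) (x : (pathCpx L).X i) :
    μ.path.app o i i (by omega) (((incl K).f o).hom e) x = x := by
  refine pathCpx.ext (fun m => ?_) (fun m => ?_)
  · simp only [fst_path_app, fst_incl, T_smul_eq_self he, H]
  · simp only [snd_path_app, fst_incl, snd_incl, T_smul_eq_self he, H]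
    rw [map_zero, AddMonoidHom.zero_apply, zero_add, (Int.negOnePow_eq_one_iff o).2 (by simp [ho]),
      one_smul]

theorem path_one_right {μ : Pairing L K L} {o : ℤ} (ho : o = 0) {e : K.X o}
    (he : (T 1 : k[T;T⁻¹]) • e = e) (H : ∀ (i : ℤ) (x : L.X i), μ.app i o i (by omega) x e = x)
    (i : ℤ) (x : (pathCpx L).X i) :
    μ.path.app i o i (by omega) x (((incl K).f o).hom e) = x := by
  refine pathCpx.ext (fun m => ?_) (fun m => ?_)
  · simp only [fst_path_app, fst_incl, T_smul_eq_self he, H]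
  · simp only [snd_path_app, fst_incl, snd_incl, T_smul_eq_self he, H]
    rw [map_zero, smul_zero, add_zero]

end Pairing

end Path

/-! ### The subcomplex of large weights -/

section Weight

variable {k : Type} [Field k]

/-- The numbers of weight at least `a`. -/
def weightGE (wt : kˣ →* Multiplicative ℝ) (a : ℝ) : Set kˣ := {α | a ≤ (wt α).toAdd}

/-- The numbers of weight `a`. -/
def weightEQ (wt : kˣ →* Multiplicative ℝ) (a : ℝ) : Set kˣ := {α | (wt α).toAdd = a}

/-- The numbers of weight greater than `a`. -/
def weightGT (wt : kˣ →* Multiplicative ℝ) (a : ℝ) : Set kˣ := {α | a < (wt α).toAdd}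

variable (wt : kˣ →* Multiplicative ℝ)

theorem disjoint_weightEQ_weightGT (a : ℝ) : Disjoint (weightEQ wt a) (weightGT wt a) :=
  Set.disjoint_left.2 fun _ h h' => ne_of_gt (show a < _ from h') h

theorem disjoint_weightEQ {a b : ℝ} (h : a ≠ b) : Disjoint (weightEQ wt a) (weightEQ wt b) :=
  Set.disjoint_left.2 fun _ h₁ h₂ => h (h₁.symm.trans h₂)

theorem weightGE_subset_union (a : ℝ) : weightGE wt a ⊆ weightEQ wt a ∪ weightGT wt a :=
  fun _ h => (eq_or_lt_of_le (show a ≤ _ from h)).imp Eq.symm id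

theorem weightEQ_subset_weightGE (a : ℝ) : weightEQ wt a ⊆ weightGE wt a :=
  fun _ h => le_of_eq (Eq.symm h)

theorem weightGT_subset_weightGE (a : ℝ) : weightGT wt a ⊆ weightGE wt a :=
  fun _ h => le_of_lt (show a < _ from h)

theorem weightGE_subset_weightGT {a b : ℝ} (h : a < b) : weightGE wt b ⊆ weightGT wt a :=
  fun _ h' => lt_of_lt_of_le h h'

theorem weightGE_mono {a b : ℝ} (h : a ≤ b) : weightGE wt b ⊆ weightGE wt a :=
  fun _ h' => le_trans h h'

theorem mul_mem_weightGE {a b c : ℝ} (h : a + b = c) (α : kˣ) (hα : α ∈ weightGE wt a) (β : kˣ)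
    (hβ : β ∈ weightGE wt b) : α * β ∈ weightGE wt c := by
  subst h
  rw [weightGE, Set.mem_ofPred_eq, map_mul, toAdd_mul]
  exact add_le_add hα hβ

theorem mul_mem_weightGT_left {a b c : ℝ} (h : a + b = c) (α : kˣ) (hα : α ∈ weightGT wt a)
    (β : kˣ) (hβ : β ∈ weightGE wt b) : α * β ∈ weightGT wt c := by
  subst h
  rw [weightGT, Set.mem_ofPred_eq, map_mul, toAdd_mul]
  exact add_lt_add_of_lt_of_le hα hβ

theorem mul_mem_weightGT_right {a b c : ℝ} (h : a + b = c) (α : kˣ) (hα : α ∈ weightGE wt a)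
    (β : kˣ) (hβ : β ∈ weightGT wt b) : α * β ∈ weightGT wt c := by
  subst h
  rw [weightGT, Set.mem_ofPred_eq, map_mul, toAdd_mul]
  exact add_lt_add_of_le_of_lt hα hβ

variable {K L M : Cpx k}

variable (K) in
/-- The largest subcomplex of `K` with weights at least `n` in degree `n`. -/
def weightSub (n : ℤ) : Submodule k[T;T⁻¹] (K.X n) :=
  rootTorsion _ (weightGE wt n) ⊓
    (rootTorsion _ (weightGE wt ((n + 1 : ℤ) : ℝ))).comap (K.d n (n + 1)).hom

variable {wt} in
theorem mem_weightSub {n : ℤ} {x : K.X n} : x ∈ weightSub wt K n ↔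
    x ∈ rootTorsion _ (weightGE wt n) ∧
      (K.d n (n + 1)).hom x ∈ rootTorsion _ (weightGE wt ((n + 1 : ℤ) : ℝ)) := Iff.rfl

variable {wt} in
theorem d_mem_weightSub {i j : ℤ} {x : K.X i} (hx : x ∈ weightSub wt K i) :
    (K.d i j).hom x ∈ weightSub wt K j := by
  by_cases h : i + 1 = j
  · subst h
    exact mem_weightSub.2 ⟨hx.2, by rw [d_d]; exact zero_mem _⟩
  · rw [K.shape i j h]
    exact zero_mem _

variable {wt} in
theorem map_mem_weightSub (f : K ⟶ L) {i : ℤ} {x : K.X i} (hx : x ∈ weightSub wt K i) :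
    (f.f i).hom x ∈ weightSub wt L i :=
  mem_weightSub.2 ⟨map_mem_rootTorsion _ hx.1, by
    rw [hom_d]; exact map_mem_rootTorsion _ hx.2⟩

variable {wt} in
theorem Pairing.app_mem_rootTorsion (μ : Pairing K L M) {S S' U : Set kˣ}
    (hU : ∀ α ∈ S, ∀ β ∈ S', α * β ∈ U) {i j n : ℤ} (h : i + j = n) {x : K.X i} {y : L.X j}
    (hx : x ∈ rootTorsion _ S) (hy : y ∈ rootTorsion _ S') :
    μ.app i j n h x y ∈ rootTorsion _ U :=
  pairing_mem_rootTorsion _ (μ.smul_left i j n h) (μ.smul_right i j n h) (μ.t_smul i j n h) hU hx hy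

variable {wt} in
theorem Pairing.app_mem_weightSub (μ : Pairing K L M) {i j n : ℤ} (h : i + j = n) {x : K.X i}
    {y : L.X j} (hx : x ∈ weightSub wt K i) (hy : y ∈ weightSub wt L j) :
    μ.app i j n h x y ∈ weightSub wt M n := by
  refine mem_weightSub.2 ⟨μ.app_mem_rootTorsion
    (mul_mem_weightGE wt (by rw [← h]; push_cast; ring)) h hx.1 hy.1, ?_⟩
  rw [μ.leibniz, Units.smul_def]
  exact add_mem
    (μ.app_mem_rootTorsion (mul_mem_weightGE wt (by rw [← h]; push_cast; ring)) _ hx.2 hy.1)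
    (zsmul_mem (μ.app_mem_rootTorsion (mul_mem_weightGE wt (by rw [← h]; push_cast; ring)) _
      hx.1 hy.2) _)

variable (K) in
/-- The differential on `weightSub`. -/
def weightD (i j : ℤ) : weightSub wt K i →ₗ[k[T;T⁻¹]] weightSub wt K j :=
  (K.d i j).hom.restrict fun _ => d_mem_weightSub

variable (K) in
/-- `weightSub` as a complex. -/
def weightCpx : Cpx k where
  X n := ModuleCat.of _ (weightSub wt K n)
  d i j := ModuleCat.ofHom (weightD wt K i j)
  shape i j h := by
    refine congrArg ModuleCat.ofHom (?_ : weightD wt K i j = 0)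
    refine LinearMap.ext fun x => Subtype.ext ?_
    change (K.d i j).hom x.1 = 0
    rw [K.shape i j h]
    rfl
  d_comp_d' i j l _ _ := by
    rw [← ModuleCat.ofHom_comp]
    refine congrArg ModuleCat.ofHom (?_ : (weightD wt K j l).comp (weightD wt K i j) = 0)
    exact LinearMap.ext fun x => Subtype.ext (d_d i j l x.1)

namespace weightCpx

variable {wt}

/-- The element of the weight subcomplex given by an element of the complex. -/
def mk {n : ℤ} (x : K.X n) (hx : x ∈ weightSub wt K n) : (weightCpx wt K).X n := ⟨x, hx⟩

/-- The underlying element. -/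
def val {n : ℤ} : (weightCpx wt K).X n →ₗ[k[T;T⁻¹]] K.X n := (weightSub wt K n).subtype

@[simp] theorem val_mk {n : ℤ} (x : K.X n) (hx : x ∈ weightSub wt K n) : val (mk x hx) = x := rfl

theorem val_mem {n : ℤ} (x : (weightCpx wt K).X n) : val x ∈ weightSub wt K n := x.2

theorem ext {n : ℤ} {x y : (weightCpx wt K).X n} (h : val x = val y) : x = y := Subtype.ext h

@[simp] theorem val_d {i j : ℤ} (x : (weightCpx wt K).X i) :
    val (((weightCpx wt K).d i j).hom x) = (K.d i j).hom (val x) := rfl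

/-- The map of weight subcomplexes induced by a map of complexes. -/
def map (φ : K ⟶ L) : weightCpx wt K ⟶ weightCpx wt L where
  f n := ModuleCat.ofHom ((φ.f n).hom.restrict fun _ => map_mem_weightSub φ)
  comm' i j _ := by
    ext x
    exact ext (hom_d φ i j x.1)

@[simp] theorem val_map (φ : K ⟶ L) {n : ℤ} (x : (weightCpx wt K).X n) :
    val (((map φ).f n).hom x) = (φ.f n).hom (val x) := rfl

theorem map_id : map (𝟙 K) = 𝟙 (weightCpx wt K) := rfl

theorem map_comp (φ : K ⟶ L) (ψ : L ⟶ M) :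
    map (wt := wt) (φ ≫ ψ) = map φ ≫ map ψ := rfl

variable (wt K) in
/-- The inclusion of the weight subcomplex. -/
def incl : weightCpx wt K ⟶ K where
  f _ := ModuleCat.ofHom val
  comm' _ _ _ := rfl

@[simp] theorem incl_f {n : ℤ} (x : (weightCpx wt K).X n) : ((incl wt K).f n).hom x = val x := rfl

theorem incl_naturality (φ : K ⟶ L) : map φ ≫ incl wt L = incl wt K ≫ φ := rfl

end weightCpx

/-! ### Products on the subcomplex of large weights -/

namespace Pairing

variable {wt} (μ : Pairing K L M)

/-- The restriction of a pairing to the weight subcomplexes. -/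
def weightFun (i j n : ℤ) (h : i + j = n) (x : (weightCpx wt K).X i) (y : (weightCpx wt L).X j) :
    (weightCpx wt M).X n :=
  weightCpx.mk (μ.app i j n h (weightCpx.val x) (weightCpx.val y))
    (μ.app_mem_weightSub h (weightCpx.val_mem x) (weightCpx.val_mem y))

@[simp] theorem val_weightFun (i j n : ℤ) (h : i + j = n) (x : (weightCpx wt K).X i)
    (y : (weightCpx wt L).X j) : weightCpx.val (μ.weightFun i j n h x y) =
      μ.app i j n h (weightCpx.val x) (weightCpx.val y) := rfl

/-- The pairing of weight subcomplexes induced by a pairing. -/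
def weight : Pairing (weightCpx wt K) (weightCpx wt L) (weightCpx wt M) where
  app i j n h := AddMonoidHom.mk'
    (fun x => AddMonoidHom.mk' (μ.weightFun i j n h x) fun _ _ => weightCpx.ext (by simp))
    fun _ _ => AddMonoidHom.ext fun _ => weightCpx.ext (by simp)
  smul_left i j n h c x y := weightCpx.ext (by simp [μ.smul_left])
  smul_right i j n h c x y := weightCpx.ext (by simp [μ.smul_right])
  t_smul i j n h x y := weightCpx.ext (by simp [μ.t_smul])
  leibniz i j n h x y := weightCpx.ext (by simp [μ.leibniz])

@[simp] theorem val_weight_app {i j n : ℤ} (h : i + j = n)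
    (x : (weightCpx wt K).X i) (y : (weightCpx wt L).X j) :
    weightCpx.val (μ.weight.app i j n h x y) =
      μ.app i j n h (weightCpx.val x) (weightCpx.val y) := rfl

end Pairing

variable (K) in
/-- The cohomology of the complex `K` in degree `i` has weight `i`. -/
def HasPureCohomology : Prop :=
  ∀ (i : ℤ) (c : Coh K i), c ∈ rootTorsion (Coh K i) (weightEQ wt i)

variable {wt}

theorem HasPureCohomology.of_bijective (hK : HasPureCohomology wt K) (f : K ⟶ L)
    (hf : ∀ i, Function.Bijective (cohMap f i)) : HasPureCohomology wt L := by
  intro i c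
  obtain ⟨c, rfl⟩ := (hf i).2 c
  exact map_mem_rootTorsion _ (hK i c)

theorem cls_mem_rootTorsion {S : Set kˣ} {i : ℤ} {x : K.X i} (hx : (K.d i (i + 1)).hom x = 0)
    (h : x ∈ rootTorsion _ S) : cls x hx ∈ rootTorsion (Coh K i) S := by
  obtain ⟨p, hp, h⟩ := h
  refine ⟨p, hp, ?_⟩
  rw [Pairing.smul_cls]
  exact Pairing.cls_congr h _ (map_zero _)

/-- In a complex with divisible terms and pure cohomology, the weight subcomplex computes the
cohomology. -/
theorem cohMap_weightCpx_incl_bijective (hK : HasPureCohomology wt K)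
    (hdiv : ∀ (S : Set kˣ), ∀ p ∈ rootMonoid S, ∀ (n : ℤ) (x : K.X n), ∃ y, p • y = x) (i : ℤ) :
    Function.Bijective (cohMap (weightCpx.incl wt K) i) := by
  have hi : i - 1 + 1 = i := by omega
  constructor
  · refine (injective_iff_map_eq_zero _).2 fun c hc => ?_
    obtain ⟨x, hx, rfl⟩ := exists_cls c
    have hx' : (K.d i (i + 1)).hom (weightCpx.val x) = 0 := congrArg weightCpx.val hx
    have hc' : cls (weightCpx.val x) hx' = cls (0 : K.X i) (map_zero _) := hc
    obtain ⟨y, hy⟩ := (cls_eq_iff hi _ _).1 hc'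
    rw [sub_zero] at hy
    obtain ⟨p, hp, hpx⟩ := (weightCpx.val_mem x).1
    -- The primitive `y` itself may be no generalized eigenvector, but `p y` is a cocycle, to which
    -- purity in degree `i - 1` applies.
    have hpy : (K.d (i - 1) (i - 1 + 1)).hom (p • y) = 0 := by
      obtain ⟨j, hj⟩ : ∃ j, j = i - 1 + 1 := ⟨_, rfl⟩
      rw [← hj]
      obtain rfl : j = i := by omega
      rw [map_smul, hy, hpx]
    obtain ⟨q, hq, hqy⟩ := hK (i - 1) (cls (p • y) hpy)
    rw [Pairing.smul_cls] at hqy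
    obtain ⟨z, hz⟩ := (cls_eq_iff (show i - 1 - 1 + 1 = i - 1 by omega) _ (map_zero _)).1 hqy
    -- Now `q p y` is the coboundary of `z`. Dividing `z` by `q p` yields `y - d z'`, which has the
    -- same differential as `y` and is killed by `q p`, hence has weights at least `i - 1`.
    obtain ⟨z', rfl⟩ := hdiv (weightGE wt (i - 1 : ℤ)) (q * p)
      (mul_mem (rootMonoid_mono (weightEQ_subset_weightGE wt _) hq)
        (rootMonoid_mono (weightGE_mono wt (by push_cast; linarith)) hp)) _ z
    have hdy : (K.d (i - 1) i).hom (y - (K.d (i - 1 - 1) (i - 1)).hom z') = weightCpx.val x := by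
      rw [map_sub, d_d, sub_zero, hy]
    refine (cls_eq_iff hi hx (map_zero _)).2
      ⟨weightCpx.mk (y - (K.d (i - 1 - 1) (i - 1)).hom z') (mem_weightSub.2 ⟨?_, ?_⟩), ?_⟩
    · refine ⟨q * p, mul_mem (rootMonoid_mono (weightEQ_subset_weightGE wt _) hq)
        (rootMonoid_mono (weightGE_mono wt (by push_cast; linarith)) hp), ?_⟩
      rw [smul_sub, ← map_smul, hz, mul_smul, sub_zero, sub_self]
    · obtain ⟨j, hj⟩ : ∃ j, j = i - 1 + 1 := ⟨_, rfl⟩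
      rw [← hj]
      obtain rfl : j = i := by omega
      rw [hdy]
      exact (weightCpx.val_mem x).1
    · refine weightCpx.ext ?_
      rw [weightCpx.val_d, weightCpx.val_mk, hdy, sub_zero]
  · intro c
    obtain ⟨p, hp, hc⟩ := hK i c
    obtain ⟨x, hx, rfl⟩ := exists_cls c
    rw [Pairing.smul_cls] at hc
    obtain ⟨y, hy⟩ := (cls_eq_iff hi _ (map_zero _)).1 hc
    -- Purity only kills the class of `x`, so `p x` is the coboundary of `y`; after division by `p`,
    -- the representative `x - d y'` is itself killed by `p`.
    obtain ⟨y', rfl⟩ := hdiv _ p hp _ y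
    rw [sub_zero, map_smul] at hy
    have hd : (K.d i (i + 1)).hom (x - (K.d (i - 1) i).hom y') = 0 := by
      rw [map_sub, d_d, hx, sub_zero]
    have hw : x - (K.d (i - 1) i).hom y' ∈ weightSub wt K i :=
      mem_weightSub.2 ⟨rootTorsion_mono (weightEQ_subset_weightGE wt _)
        (mem_rootTorsion.2 ⟨p, hp, by rw [smul_sub, hy, sub_self]⟩), by
          rw [hd]; exact zero_mem _⟩
    refine ⟨cls (weightCpx.mk _ hw)
      (weightCpx.ext (by rw [weightCpx.val_d, weightCpx.val_mk, hd, map_zero])), ?_⟩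
    · rw [cohMap_cls]
      refine (cls_eq_iff hi _ _).2 ⟨-y', ?_⟩
      rw [weightCpx.incl_f, weightCpx.val_mk, map_neg]
      abel

/-! ### The leading class of an element of the weight subcomplex -/

/-- Take for `z` the part of weight exactly `n`. Its differential has weight `n`, yet it is the
difference of `d x`, of weights at least `n + 1`, and the differential of a part of weights above
`n`; hence it vanishes. -/
theorem exists_leading_cocycle {n : ℤ} {x : K.X n} (hx : x ∈ weightSub wt K n) :
    ∃ z : K.X n, (K.d n (n + 1)).hom z = 0 ∧ x - z ∈ rootTorsion _ (weightGT wt n) := by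
  obtain ⟨z, hz, y, hy, rfl⟩ := exists_add_of_mem_rootTorsion (disjoint_weightEQ_weightGT wt n)
    (weightGE_subset_union wt n) hx.1
  refine ⟨z, eq_zero_of_mem_rootTorsion (disjoint_weightEQ_weightGT wt n)
    (map_mem_rootTorsion _ hz) ?_, by rwa [add_sub_cancel_left]⟩
  have h := sub_mem (rootTorsion_mono (weightGE_subset_weightGT wt
    (show (n : ℝ) < ((n + 1 : ℤ) : ℝ) by push_cast; linarith)) hx.2)
    (map_mem_rootTorsion (K.d n (n + 1)).hom hy)
  rwa [map_add, add_sub_cancel_right] at h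

/-- The difference of the classes has weight `n` by purity and weights above `n` by assumption, so
it is zero. This makes the leading class independent of the chosen cocycle. -/
theorem HasPureCohomology.cls_eq (hK : HasPureCohomology wt K) {n : ℤ} {z z' : K.X n}
    (hz : (K.d n (n + 1)).hom z = 0) (hz' : (K.d n (n + 1)).hom z' = 0)
    (h : z - z' ∈ rootTorsion _ (weightGT wt n)) : cls z hz = cls z' hz' := by
  have hd : (K.d n (n + 1)).hom (z - z') = 0 := by rw [map_sub, hz, hz', sub_zero]
  have : cls (z - z') hd = 0 := eq_zero_of_mem_rootTorsion (disjoint_weightEQ_weightGT wt n)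
    (hK n _) (cls_mem_rootTorsion hd h)
  rw [← sub_eq_zero]
  exact this

/-- The class of the part of weight `n` of an element of degree `n`. -/
def leadingClass {n : ℤ} (x : (weightCpx wt K).X n) : Coh K n :=
  cls (exists_leading_cocycle (weightCpx.val_mem x)).choose
    (exists_leading_cocycle (weightCpx.val_mem x)).choose_spec.1

theorem leadingClass_eq (hK : HasPureCohomology wt K) {n : ℤ} (x : (weightCpx wt K).X n) {z : K.X n}
    (hz : (K.d n (n + 1)).hom z = 0)
    (h : weightCpx.val x - z ∈ rootTorsion _ (weightGT wt n)) : leadingClass x = cls z hz := by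
  refine hK.cls_eq _ _ ?_
  have := sub_mem h (exists_leading_cocycle (weightCpx.val_mem x)).choose_spec.2
  rwa [sub_sub_sub_cancel_left] at this

theorem leadingClass_of_cocycle (hK : HasPureCohomology wt K) {n : ℤ} (x : (weightCpx wt K).X n)
    (hx : (K.d n (n + 1)).hom (weightCpx.val x) = 0) :
    leadingClass x = cls (weightCpx.val x) hx :=
  leadingClass_eq hK x hx (by rw [sub_self]; exact zero_mem _)

/-- The projection of the weight subcomplex to the cohomology. -/
def leadingMap (hK : HasPureCohomology wt K) : weightCpx wt K ⟶ cohCpx K where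
  f n := ModuleCat.ofHom (Y := Coh K n)
    { toFun := leadingClass
      map_add' := fun x y => by
        obtain ⟨z, hz, h⟩ := exists_leading_cocycle (weightCpx.val_mem x)
        obtain ⟨z', hz', h'⟩ := exists_leading_cocycle (weightCpx.val_mem y)
        rw [leadingClass_eq hK x hz h, leadingClass_eq hK y hz' h', Pairing.add_cls]
        refine leadingClass_eq hK _ _ ?_
        have := add_mem h h'
        rw [← add_sub_add_comm] at this
        exact this
      map_smul' := fun r x => by
        obtain ⟨z, hz, h⟩ := exists_leading_cocycle (weightCpx.val_mem x)
        rw [leadingClass_eq hK x hz h, RingHom.id_apply, Pairing.smul_cls]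
        refine leadingClass_eq hK _ _ ?_
        have := Submodule.smul_mem _ r h
        rw [smul_sub] at this
        exact this }
  comm' i j h := by
    obtain rfl : i + 1 = j := h
    ext x
    -- The target has zero differential, so the leading class of `d x` must vanish; it is the class
    -- of the cocycle `d x` itself, a coboundary.
    refine Eq.symm ((leadingClass_of_cocycle hK (((weightCpx wt K).d i (i + 1)).hom x)
      (d_d _ _ _ _)).trans ?_)
    exact (cls_eq_iff rfl _ (map_zero _)).2 ⟨weightCpx.val x, by rw [sub_zero]; rfl⟩

theorem leadingClass_map (hL : HasPureCohomology wt L) (φ : K ⟶ L)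
    {n : ℤ} (x : (weightCpx wt K).X n) :
    leadingClass (((weightCpx.map φ).f n).hom x) = cohMap φ n (leadingClass x) := by
  obtain ⟨hz, h⟩ := (exists_leading_cocycle (weightCpx.val_mem x)).choose_spec
  rw [leadingClass.eq_def x, cohMap_cls]
  refine leadingClass_eq hL _ _ ?_
  rw [weightCpx.val_map, ← map_sub]
  exact map_mem_rootTorsion _ h

theorem leadingMap_naturality (hK : HasPureCohomology wt K) (hL : HasPureCohomology wt L)
    (φ : K ⟶ L) : weightCpx.map φ ≫ leadingMap hL = leadingMap hK ≫ cohCpxMap φ := by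
  ext n x
  exact leadingClass_map hL φ x

/-- A cocycle is its own leading part. Hence the projection is a quasi-isomorphism as soon as the
inclusion is, and the whole zigzag induces the tautological map on cohomology. -/
theorem cohCpxMap_leadingMap (hK : HasPureCohomology wt K) :
    cohCpxMap (leadingMap hK) = cohCpxMap (weightCpx.incl wt K) ≫ cohCpxSelf K := by
  ext n x
  obtain ⟨x, hx, rfl⟩ := exists_cls x
  exact Pairing.cls_congr (leadingClass_of_cocycle hK x (congrArg weightCpx.val hx)) _ _

/-- With leading cocycles `z` and `z'`, write `x y - z z' = (x - z) y + z (y - z')`; since weights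
add, both terms have weights above `n`. -/
theorem leadingClass_mul (hM : HasPureCohomology wt M)
    (μ : Pairing K L M) {i j n : ℤ} (h : i + j = n)
    (x : (weightCpx wt K).X i) (y : (weightCpx wt L).X j) :
    leadingClass (μ.weight.app i j n h x y) =
      μ.cohFun i j n h (leadingClass x) (leadingClass y) := by
  obtain ⟨hz, hx⟩ := (exists_leading_cocycle (weightCpx.val_mem x)).choose_spec
  obtain ⟨hz', hy⟩ := (exists_leading_cocycle (weightCpx.val_mem y)).choose_spec
  rw [leadingClass.eq_def x, leadingClass.eq_def y, Pairing.cohFun_cls]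
  refine leadingClass_eq hM _ _ ?_
  set z := (exists_leading_cocycle (weightCpx.val_mem x)).choose
  set z' := (exists_leading_cocycle (weightCpx.val_mem y)).choose
  -- The chosen cocycle is known only through `x - z`, so its weights are read off from `z = x - (x
  -- - z)`.
  have hzm : z ∈ rootTorsion _ (weightGE wt i) := by
    have := sub_mem (weightCpx.val_mem x).1 (rootTorsion_mono (weightGT_subset_weightGE wt _) hx)
    rwa [sub_sub_cancel] at this
  have hc : (i : ℝ) + j = n := by rw [← h]; push_cast; ring
  have := add_mem
    (μ.app_mem_rootTorsion (mul_mem_weightGT_left wt hc) h hx (weightCpx.val_mem y).1)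
    (μ.app_mem_rootTorsion (mul_mem_weightGT_right wt hc) h hzm hy)
  rw [Pairing.val_weight_app]
  convert this using 1
  simp

/-- The eigenvalue `1` has weight `0`; this places the unit of an algebra in the weight subalgebra.
-/
theorem mem_weightSub_zero_of_fixed {x : K.X 0} (hd : (K.d 0 (0 + 1)).hom x = 0)
    (ht : (T 1 : k[T;T⁻¹]) • x = x) : x ∈ weightSub wt K 0 := by
  refine mem_weightSub.2 ⟨⟨T 1 - C ((1 : kˣ) : k), mem_rootMonoid ?_, ?_⟩, ?_⟩
  · rw [weightGE, Set.mem_ofPred_eq, map_one]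
    simp
  · rw [sub_smul, ht, Units.val_one, map_one, one_smul, sub_self]
  · rw [hd]
    exact zero_mem _

end Weight

/-! ### The constructions for algebras and modules -/

section Complexes

variable {k : Type} [Field k] {K L : Cpx k}

/-- A complex with zero differential is its own cohomology. -/
def zeroSelf (K : Cpx k) (hK : ∀ i j, K.d i j = 0) : K ⟶ cohCpx K where
  f n := ModuleCat.ofHom
    { toFun := fun x => cls x (by rw [hK]; rfl)
      map_add' := fun _ _ => rfl
      map_smul' := fun _ _ => rfl }
  comm' i j _ := by
    ext x
    refine Eq.trans (b := (0 : Coh K j)) rfl (Eq.symm ((cls_eq_iff (sub_add_cancel j 1) _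
      (map_zero _)).2 ⟨0, ?_⟩))
    rw [map_zero, hK, sub_zero]
    rfl

theorem zeroSelf_bijective (hK : ∀ i j, K.d i j = 0) (n : ℤ) :
    Function.Bijective (((zeroSelf K hK).f n).hom : K.X n → Coh K n) := by
  constructor
  · intro x y h
    obtain ⟨z, hz⟩ := (cls_eq_iff (show n - 1 + 1 = n by omega) _ _).1 h
    rw [hK] at hz
    exact (sub_eq_zero.1 hz.symm)
  · intro c
    obtain ⟨x, hx, rfl⟩ := exists_cls c
    exact ⟨x, rfl⟩

theorem zeroSelf_naturality (f : K ⟶ L) (hK : ∀ i j, K.d i j = 0) (hL : ∀ i j, L.d i j = 0) :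
    f ≫ zeroSelf L hL = zeroSelf K hK ≫ cohCpxMap f := rfl

theorem cohCpxSelf_bijective (K : Cpx k) (n : ℤ) :
    Function.Bijective (((cohCpxSelf K).f n).hom : Coh K n → Coh (cohCpx K) n) :=
  zeroSelf_bijective (K := cohCpx K) (fun _ _ => rfl) n

theorem isIso_of_bijective (f : K ⟶ L) (hf : ∀ n, Function.Bijective (f.f n).hom) : IsIso f := by
  have : ∀ n, IsIso (f.f n) := fun n => (ConcreteCategory.isIso_iff_bijective _).2 (hf n)
  exact HomologicalComplex.Hom.isIso_of_components f

theorem bijective_of_isIso (f : K ⟶ L) [IsIso f] (n : ℤ) : Function.Bijective (f.f n).hom :=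
  ConcreteCategory.bijective_of_isIso (f.f n)

end Complexes

variable {k : Type} [Field k] (wt : kˣ →* Multiplicative ℝ)

/-! ### Path objects, weights and leading classes for dg algebras -/

namespace DGAlg

variable {A B : DGAlg k}

theorem isIso_of_bijective (f : A ⟶ B) (hf : ∀ n, Function.Bijective (f.map.f n).hom) :
    IsIso f := by
  have := PureFormality.isIso_of_bijective f.map hf
  have h : ∀ n (x : B.cpx.X n), (f.map.f n).hom (((inv f.map).f n).hom x) = x := fun n x => by
    have := congrArg (fun g : B.cpx ⟶ B.cpx => (g.f n).hom x) (IsIso.inv_hom_id f.map)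
    exact this
  refine ⟨⟨⟨inv f.map, (hf 0).1 ?_, fun i j n hn x y => (hf n).1 ?_⟩, ?_, ?_⟩⟩
  · rw [h, f.map_one]
  · rw [h, f.map_mul, h, h]
  · ext1; exact IsIso.hom_inv_id f.map
  · ext1; exact IsIso.inv_hom_id f.map

variable (k) in
/-- The underlying complex. -/
def toCpx : DGAlg k ⥤ Cpx k where
  obj A := A.cpx
  map f := f.map

theorem isIso_cohFunctor_map_iff (f : A ⟶ B) :
    IsIso ((cohFunctor k).map f) ↔ ∀ i, Function.Bijective (cohMap f.map i) := by
  refine ⟨fun _ i => ?_, fun h => isIso_of_bijective _ h⟩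
  exact PureFormality.bijective_of_isIso ((toCpx k).map ((cohFunctor k).map f)) i

/-- Cochains on the real line with values in a dg algebra. -/
def path (A : DGAlg k) : DGAlg k where
  cpx := pathCpx A.cpx
  mul := A.mul.path
  one := ((pathCpx.incl A.cpx).f 0).hom A.one
  d_one := by rw [hom_d, A.d_one, map_zero]
  t_one := by rw [← map_smul, A.t_one]
  one_mul := Pairing.path_one_left rfl A.t_one A.one_mul
  mul_one := Pairing.path_one_right rfl A.t_one A.mul_one
  mul_assoc := Pairing.Assoc.path A.mul_assoc

variable (k) in
/-- `DGAlg.path` as a functor. -/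
def pathFunctor : DGAlg k ⥤ DGAlg k where
  obj A := A.path
  map {A B} f :=
    { map := pathCpx.map f.map
      map_one := by
        have h := congrArg (fun g => (g.f 0).hom A.one) (pathCpx.incl_naturality f.map)
        exact h.symm.trans (congrArg ((pathCpx.incl B.cpx).f 0).hom f.map_one)
      map_mul := Pairing.path_app_map f.map_mul }
  map_id _ := hom_ext pathCpx.map_id
  map_comp _ _ := hom_ext (pathCpx.map_comp _ _)

variable (k) in
/-- The inclusion of an algebra in the cochains on the real line. -/
def pathIncl : 𝟭 (DGAlg k) ⟶ pathFunctor k where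
  app A :=
    { map := pathCpx.incl A.cpx
      map_one := rfl
      map_mul := A.mul.path_app_incl }
  naturality _ _ f := hom_ext (pathCpx.incl_naturality f.map)

/-- The subalgebra of elements of large weight. -/
def weight (A : DGAlg k) : DGAlg k where
  cpx := weightCpx wt A.cpx
  mul := A.mul.weight
  one := weightCpx.mk A.one (mem_weightSub_zero_of_fixed A.d_one A.t_one)
  d_one := weightCpx.ext A.d_one
  t_one := weightCpx.ext A.t_one
  one_mul i x := weightCpx.ext (by simp [A.one_mul])
  mul_one i x := weightCpx.ext (by simp [A.mul_one])
  mul_assoc i j l ij jl n h₁ h₂ h₃ h₄ x y z :=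
    weightCpx.ext (by simp [A.mul_assoc i j l ij jl n h₁ h₂ h₃ h₄])

/-- `DGAlg.weight` as a functor. -/
def weightFunctor : DGAlg k ⥤ DGAlg k where
  obj A := A.weight wt
  map f :=
    { map := weightCpx.map f.map
      map_one := weightCpx.ext f.map_one
      map_mul := fun i j n h _ _ => weightCpx.ext (f.map_mul i j n h _ _) }
  map_id _ := hom_ext weightCpx.map_id
  map_comp _ _ := hom_ext (weightCpx.map_comp _ _)

/-- The inclusion of the subalgebra of elements of large weight. -/
def weightIncl : weightFunctor wt ⟶ 𝟭 (DGAlg k) where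
  app A :=
    { map := weightCpx.incl wt A.cpx
      map_one := rfl
      map_mul := fun _ _ _ _ _ _ => rfl }
  naturality _ _ f := hom_ext (weightCpx.incl_naturality f.map)

variable {wt} in
/-- The projection of the elements of large weight to the cohomology. -/
def leading (A : DGAlg k) (hA : HasPureCohomology wt A.cpx) : A.weight wt ⟶ A.coh where
  map := leadingMap hA
  map_one := leadingClass_of_cocycle hA _ A.d_one
  map_mul _ _ _ h x y := leadingClass_mul hA A.mul h x y

variable {wt} in
theorem leading_naturality (f : A ⟶ B) (hA : HasPureCohomology wt A.cpx)
    (hB : HasPureCohomology wt B.cpx) :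
    (weightFunctor wt).map f ≫ leading B hB = leading A hA ≫ (cohFunctor k).map f :=
  hom_ext (leadingMap_naturality hA hB f.map)

variable {wt} in
theorem cohFunctor_map_leading (A : DGAlg k) (hA : HasPureCohomology wt A.cpx) :
    (cohFunctor k).map (leading A hA) =
      (cohFunctor k).map ((weightIncl wt).app A) ≫ (cohSelf k).app A :=
  hom_ext (cohCpxMap_leadingMap hA)

/-- An algebra with zero differential is its own cohomology. -/
def selfCoh (A : DGAlg k) (hA : zeroDiff k A) : A ⟶ A.coh where
  map := zeroSelf A.cpx hA
  map_one := rfl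
  map_mul _ _ _ _ _ _ := rfl

theorem isIso_selfCoh (hA : zeroDiff k A) : IsIso (selfCoh A hA) :=
  isIso_of_bijective _ (zeroSelf_bijective hA)

theorem isIso_cohSelf_app (A : DGAlg k) : IsIso ((cohSelf k).app A) :=
  isIso_of_bijective _ (cohCpxSelf_bijective A.cpx)

end DGAlg

/-! ### Path objects, weights and leading classes for pairs -/

namespace DGMod

variable {A B : DGMod k}

theorem isIso_of_bijective (f : A ⟶ B) (h₁ : ∀ n, Function.Bijective (f.algMap.map.f n).hom)
    (hf : ∀ n, Function.Bijective (f.map.f n).hom) : IsIso f := by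
  have := PureFormality.isIso_of_bijective f.map hf
  have h₁' := DGAlg.isIso_of_bijective f.algMap h₁
  have h : ∀ n (x : B.cpx.X n), (f.map.f n).hom (((inv f.map).f n).hom x) = x := fun n x => by
    have := congrArg (fun g : B.cpx ⟶ B.cpx => (g.f n).hom x) (IsIso.inv_hom_id f.map)
    exact this
  have h' : ∀ n (x : B.alg.cpx.X n),
      (f.algMap.map.f n).hom (((inv f.algMap).map.f n).hom x) = x := fun n x => by
    have := congrArg (fun g : B.alg ⟶ B.alg => (g.map.f n).hom x) (IsIso.inv_hom_id f.algMap)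
    exact this
  refine ⟨⟨⟨inv f.algMap, inv f.map, fun i j n hn x y => (hf n).1 ?_⟩, ?_, ?_⟩⟩
  · rw [h, f.map_act, h', h]
  · ext1
    · exact IsIso.hom_inv_id f.algMap
    · exact IsIso.hom_inv_id f.map
  · ext1
    · exact IsIso.inv_hom_id f.algMap
    · exact IsIso.inv_hom_id f.map

variable (k) in
/-- The underlying complex of the module. -/
def toCpx : DGMod k ⥤ Cpx k where
  obj A := A.cpx
  map f := f.map

variable (k) in
/-- The algebra. -/
def toAlg : DGMod k ⥤ DGAlg k where
  obj A := A.alg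
  map f := f.algMap

theorem isIso_cohFunctor_map_iff (f : A ⟶ B) :
    IsIso ((cohFunctor k).map f) ↔ (∀ i, Function.Bijective (cohMap f.algMap.map i)) ∧
      ∀ i, Function.Bijective (cohMap f.map i) := by
  refine ⟨fun _ => ⟨fun i => ?_, fun i => ?_⟩, fun h => isIso_of_bijective _ h.1 h.2⟩
  · exact PureFormality.bijective_of_isIso
      ((toAlg k ⋙ DGAlg.toCpx k).map ((cohFunctor k).map f)) i
  · exact PureFormality.bijective_of_isIso ((toCpx k).map ((cohFunctor k).map f)) i

/-- Cochains on the real line with values in a pair. -/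
def path (M : DGMod k) : DGMod k where
  alg := M.alg.path
  cpx := pathCpx M.cpx
  act := M.act.path
  one_act := Pairing.path_one_left rfl M.alg.t_one M.one_act
  act_assoc := Pairing.Assoc.path M.act_assoc

variable (k) in
/-- `DGMod.path` as a functor. -/
def pathFunctor : DGMod k ⥤ DGMod k where
  obj M := M.path
  map f :=
    { algMap := (DGAlg.pathFunctor k).map f.algMap
      map := pathCpx.map f.map
      map_act := Pairing.path_app_map f.map_act }
  map_id _ := hom_ext ((DGAlg.pathFunctor k).map_id _) pathCpx.map_id
  map_comp _ _ := hom_ext ((DGAlg.pathFunctor k).map_comp _ _) (pathCpx.map_comp _ _)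

variable (k) in
/-- The inclusion of a pair in the cochains on the real line. -/
def pathIncl : 𝟭 (DGMod k) ⟶ pathFunctor k where
  app M :=
    { algMap := (DGAlg.pathIncl k).app M.alg
      map := pathCpx.incl M.cpx
      map_act := M.act.path_app_incl }
  naturality _ _ f := hom_ext ((DGAlg.pathIncl k).naturality f.algMap)
    (pathCpx.incl_naturality f.map)

/-- The elements of large weight in a pair. -/
def weight (M : DGMod k) : DGMod k where
  alg := M.alg.weight wt
  cpx := weightCpx wt M.cpx
  act := M.act.weight
  one_act i _ := weightCpx.ext (M.one_act i _)
  act_assoc i j l ij jl n h₁ h₂ h₃ h₄ _ _ _ :=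
    weightCpx.ext (M.act_assoc i j l ij jl n h₁ h₂ h₃ h₄ _ _ _)

/-- `DGMod.weight` as a functor. -/
def weightFunctor : DGMod k ⥤ DGMod k where
  obj M := M.weight wt
  map f :=
    { algMap := (DGAlg.weightFunctor wt).map f.algMap
      map := weightCpx.map f.map
      map_act := fun i j n h _ _ => weightCpx.ext (f.map_act i j n h _ _) }
  map_id _ := hom_ext ((DGAlg.weightFunctor wt).map_id _) weightCpx.map_id
  map_comp _ _ := hom_ext ((DGAlg.weightFunctor wt).map_comp _ _) (weightCpx.map_comp _ _)

/-- The inclusion of the elements of large weight. -/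
def weightIncl : weightFunctor wt ⟶ 𝟭 (DGMod k) where
  app M :=
    { algMap := (DGAlg.weightIncl wt).app M.alg
      map := weightCpx.incl wt M.cpx
      map_act := fun _ _ _ _ _ _ => rfl }
  naturality _ _ f := hom_ext ((DGAlg.weightIncl wt).naturality f.algMap)
    (weightCpx.incl_naturality f.map)

variable {wt} in
/-- The projection of the elements of large weight to the cohomology. -/
def leading (M : DGMod k) (hA : HasPureCohomology wt M.alg.cpx)
    (hM : HasPureCohomology wt M.cpx) : M.weight wt ⟶ M.coh where
  algMap := DGAlg.leading M.alg hA
  map := leadingMap hM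
  map_act _ _ _ h x y := leadingClass_mul hM M.act h x y

variable {wt} in
theorem leading_naturality {M N : DGMod k} (f : M ⟶ N) (hA : HasPureCohomology wt M.alg.cpx)
    (hM : HasPureCohomology wt M.cpx) (hB : HasPureCohomology wt N.alg.cpx)
    (hN : HasPureCohomology wt N.cpx) :
    (weightFunctor wt).map f ≫ leading N hB hN = leading M hA hM ≫ (cohFunctor k).map f :=
  hom_ext (DGAlg.leading_naturality f.algMap hA hB) (leadingMap_naturality hM hN f.map)

variable {wt} in
theorem cohFunctor_map_leading (M : DGMod k) (hA : HasPureCohomology wt M.alg.cpx)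
    (hM : HasPureCohomology wt M.cpx) : (cohFunctor k).map (leading M hA hM) =
      (cohFunctor k).map ((weightIncl wt).app M) ≫ (cohSelf k).app M :=
  hom_ext (DGAlg.cohFunctor_map_leading M.alg hA) (cohCpxMap_leadingMap hM)

/-- A pair with zero differentials is its own cohomology. -/
def selfCoh (M : DGMod k) (hM : zeroDiff k M) : M ⟶ M.coh where
  algMap := DGAlg.selfCoh M.alg hM.1
  map := zeroSelf M.cpx hM.2
  map_act _ _ _ _ _ _ := rfl

theorem isIso_selfCoh {M : DGMod k} (hM : zeroDiff k M) : IsIso (selfCoh M hM) :=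
  isIso_of_bijective _ (zeroSelf_bijective hM.1) (zeroSelf_bijective hM.2)

theorem isIso_cohSelf_app (M : DGMod k) : IsIso ((cohSelf k).app M) :=
  isIso_of_bijective _ (cohCpxSelf_bijective M.alg.cpx) (cohCpxSelf_bijective M.cpx)

end DGMod

/-! ### Canonical formality from a natural zigzag -/

section Localization

variable {𝒜 : Type*} [Category* 𝒜] {ℬ : Type*} [Category* ℬ] (W : MorphismProperty 𝒜)

/-- A functor that inverts `W` and has a right inverse which is a left inverse after inverting `W`
induces an equivalence on the localization. -/
theorem isEquivalence_lift_of_section (L : 𝒜 ⥤ ℬ) (hL : W.IsInvertedBy L) (S : ℬ ⥤ 𝒜)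
    (ε : S ⋙ L ≅ 𝟭 ℬ) (α : W.Q ≅ L ⋙ S ⋙ W.Q) :
    (Localization.Construction.lift L hL).IsEquivalence := by
  have i : W.Q ⋙ Localization.Construction.lift L hL ≅ L :=
    eqToIso (Localization.Construction.fac L hL)
  let _ : Localization.Lifting W.Q W (L ⋙ S ⋙ W.Q)
      (Localization.Construction.lift L hL ⋙ S ⋙ W.Q) :=
    ⟨(Functor.associator _ _ _).symm ≪≫ Functor.isoWhiskerRight i (S ⋙ W.Q)⟩
  let _ : Localization.Lifting W.Q W W.Q (𝟭 W.Localization) := ⟨Functor.rightUnitor _⟩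
  exact (CategoryTheory.Equivalence.mk (Localization.Construction.lift L hL) (S ⋙ W.Q)
    (Localization.liftNatIso W.Q W W.Q (L ⋙ S ⋙ W.Q) _ _ α)
    (Functor.associator _ _ _ ≪≫ Functor.isoWhiskerLeft S i ≪≫ ε)).isEquivalence_functor

end Localization

section Zigzag

variable {𝒟 : Type u₁} [Category.{v₁} 𝒟] {H : 𝒟 ⥤ 𝒟} {P : ObjectProperty 𝒟}
  {J : Type u₂} [Category.{v₂} J]

theorem isIso_toHoDiag_map {F G : J ⥤ P.FullSubcategory} (f : F ⟶ G)
    (h : ∀ j, IsIso (H.map (f.app j).hom)) : IsIso ((toHoDiag H P J).map f) :=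
  Localization.inverts _ ((qis H P).functorCategory J) f h

/-- An objectwise quasi-isomorphism of functors on diagrams is an isomorphism after passing to the
homotopy category. -/
def toHoDiagIso {Φ Ψ : (J ⥤ P.FullSubcategory) ⥤ (J ⥤ P.FullSubcategory)} (η : Φ ⟶ Ψ)
    (h : ∀ F j, IsIso (H.map ((η.app F).app j).hom)) :
    Φ ⋙ toHoDiag H P J ≅ Ψ ⋙ toHoDiag H P J :=
  haveI : ∀ F, IsIso ((Functor.whiskerRight η (toHoDiag H P J)).app F) := fun F =>
    isIso_toHoDiag_map (η.app F) (h F)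
  haveI := NatIso.isIso_of_isIso_app (Functor.whiskerRight η (toHoDiag H P J))
  asIso (Functor.whiskerRight η (toHoDiag H P J))

theorem cohAt_toHoDiagIso_hom {Φ Ψ : (J ⥤ P.FullSubcategory) ⥤ (J ⥤ P.FullSubcategory)}
    (η : Φ ⟶ Ψ) (h : ∀ F j, IsIso (H.map ((η.app F).app j).hom)) (F : J ⥤ P.FullSubcategory)
    (j : J) : cohAt ((toHoDiagIso η h).hom.app F) j = H.map ((η.app F).app j).hom :=
  cohAt_map H P J (η.app F) j

theorem cohAt_id (F : J ⥤ P.FullSubcategory) (j : J) :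
    cohAt (𝟙 ((toHoDiag H P J).obj F)) j = 𝟙 (H.obj (F.obj j).obj) :=
  congrArg (fun a => NatTrans.app a j) ((hoCoh H P J).map_id _)

theorem cohAt_toHoDiagIso_inv {Φ Ψ : (J ⥤ P.FullSubcategory) ⥤ (J ⥤ P.FullSubcategory)}
    (η : Φ ⟶ Ψ) (h : ∀ F j, IsIso (H.map ((η.app F).app j).hom)) (F : J ⥤ P.FullSubcategory)
    (j : J) :
    cohAt ((toHoDiagIso η h).inv.app F) j ≫ H.map ((η.app F).app j).hom =
      𝟙 (H.obj ((Ψ.obj F).obj j).obj) := by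
  rw [← cohAt_toHoDiagIso_hom η h, ← cohAt_comp]
  refine Eq.trans ?_ (cohAt_id (Ψ.obj F) j)
  exact congrArg (cohAt · j) (Iso.inv_hom_id_app (toHoDiagIso η h) F)

/-- The natural transformation between functors on diagrams induced by a natural transformation
of functors. -/
def diagramNatTrans {Φ Ψ : P.FullSubcategory ⥤ P.FullSubcategory} (η : Φ ⟶ Ψ) :
    (Functor.whiskeringRight J _ _).obj Φ ⟶ (Functor.whiskeringRight J _ _).obj Ψ :=
  (Functor.whiskeringRight J _ _).map η

/-- The zigzag is `X → U X ← V X → H (U X) ← H X`, with arrows `a`, `b`, `l` and `H a`. Being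
natural on objects, it applies vertexwise to diagrams. The maps `e` say that an object with zero
differential is recovered from its cohomology. -/
theorem canonicallyFormal_of_zigzag (H : 𝒟 ⥤ 𝒟) (c : H ⟶ H ⋙ H) (Z P : ObjectProperty 𝒟)
    (hc : ∀ X, IsIso (c.app X)) (hZ : ∀ X, Z (H.obj X))
    (e : ∀ X, Z X → (X ⟶ H.obj X)) (he : ∀ X hX, IsIso (e X hX))
    (he' : ∀ X Y hX hY (f : X ⟶ Y), f ≫ e Y hY = e X hX ≫ H.map f)
    (hP : ∀ {X Y : 𝒟} (f : X ⟶ Y), IsIso (H.map f) → (P X ↔ P Y))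
    (U V : 𝒟 ⥤ 𝒟) (a : 𝟭 𝒟 ⟶ U) (b : V ⟶ U)
    (ha : ∀ X, IsIso (H.map (a.app X))) (hb : ∀ X, P X → IsIso (H.map (b.app X)))
    (l : P.ι ⋙ V ⟶ P.ι ⋙ U ⋙ H)
    (hl : ∀ X, H.map (l.app X) = H.map (b.app X.obj) ≫ c.app (U.obj X.obj)) :
    CanonicallyFormal.{v₁, u₁, v₂, u₂} H c Z P := by
  have hUP : ∀ X : P.FullSubcategory, P ((P.ι ⋙ U).obj X) := fun X =>
    (hP (a.app X.obj) (ha _)).1 X.property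
  have hVP : ∀ X : P.FullSubcategory, P ((P.ι ⋙ V).obj X) := fun X =>
    (hP (b.app X.obj) (hb _ X.property)).2 (hUP X)
  have hl' : ∀ X, IsIso (H.map (l.app X)) := fun X => by
    rw [hl]
    have := hb X.obj X.property
    have := hc (U.obj X.obj)
    infer_instance
  have hHa : ∀ X, IsIso (H.map (H.map (a.app X))) := fun X => by
    have := ha X
    infer_instance
  have hHP : ∀ X : P.FullSubcategory, P ((P.ι ⋙ H).obj X) := fun X =>
    (hP (H.map (a.app X.obj)) (hHa _)).2 ((hP (l.app X) (hl' _)).1 (hVP X))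
  have hQ : ∀ X : P.FullSubcategory, (Z ⊓ P) ((P.ι ⋙ H).obj X) := fun X => ⟨hZ _, hHP X⟩
  let HP : P.FullSubcategory ⥤ P.FullSubcategory := P.lift (P.ι ⋙ H) hHP
  let UP : P.FullSubcategory ⥤ P.FullSubcategory := P.lift (P.ι ⋙ U) hUP
  let VP : P.FullSubcategory ⥤ P.FullSubcategory := P.lift (P.ι ⋙ V) hVP
  let a' : 𝟭 P.FullSubcategory ⟶ UP :=
    { app := fun X => ObjectProperty.homMk (a.app X.obj)
      naturality := fun X Y f => InducedCategory.hom_ext (a.naturality f.hom) }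
  let b' : VP ⟶ UP :=
    { app := fun X => ObjectProperty.homMk (b.app X.obj)
      naturality := fun X Y f => InducedCategory.hom_ext (b.naturality f.hom) }
  let l' : VP ⟶ UP ⋙ HP :=
    { app := fun X => ObjectProperty.homMk (l.app X)
      naturality := fun X Y f => InducedCategory.hom_ext (l.naturality f) }
  let h' : HP ⟶ UP ⋙ HP :=
    { app := fun X => ObjectProperty.homMk (H.map (a.app X.obj))
      naturality := fun X Y f => InducedCategory.hom_ext (by
        change H.map f.hom ≫ H.map (a.app Y.obj) = H.map (a.app X.obj) ≫ H.map (U.map f.hom)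
        rw [← H.map_comp, ← H.map_comp]
        exact congrArg H.map (a.naturality f.hom)) }
  refine ⟨hQ, fun J _ => ?_⟩
  let i₁ := toHoDiagIso (H := H) (diagramNatTrans (J := J) a') fun F j => ha _
  let i₂ := toHoDiagIso (H := H) (diagramNatTrans (J := J) b') fun F j => hb _ (F.obj j).property
  let i₃ := toHoDiagIso (H := H) (diagramNatTrans (J := J) l') fun F j => hl' _
  let i₄ := toHoDiagIso (H := H) (diagramNatTrans (J := J) h') fun F j => hHa _
  let α : toHoDiag H P J ≅ (Functor.whiskeringRight J _ _).obj HP ⋙ toHoDiag H P J :=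
    (i₁ ≪≫ i₂.symm ≪≫ i₃ ≪≫ i₄.symm : _)
  have hα : ∀ (F : J ⥤ P.FullSubcategory) (j : J), cohAt (α.hom.app F) j = c.app (F.obj j).obj := by
    intro F j
    have e₀ : cohAt (α.hom.app F) j = cohAt (i₁.hom.app F) j ≫ cohAt (i₂.inv.app F) j ≫
        cohAt (i₃.hom.app F) j ≫ cohAt (i₄.inv.app F) j := by
      rw [← cohAt_comp, ← cohAt_comp, ← cohAt_comp]
      rfl
    have e₁ : cohAt (i₁.hom.app F) j = H.map (a.app (F.obj j).obj) := cohAt_toHoDiagIso_hom _ _ F j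
    have e₂ : cohAt (i₂.inv.app F) j ≫ H.map (b.app (F.obj j).obj) = 𝟙 _ :=
      cohAt_toHoDiagIso_inv _ _ F j
    have e₃ : cohAt (i₃.hom.app F) j = H.map (l.app (F.obj j)) := cohAt_toHoDiagIso_hom _ _ F j
    have e₄ : cohAt (i₄.inv.app F) j ≫ H.map (H.map (a.app (F.obj j).obj)) = 𝟙 _ :=
      cohAt_toHoDiagIso_inv _ _ F j
    have := hHa (F.obj j).obj
    rw [← cancel_mono (H.map (H.map (a.app (F.obj j).obj))), e₀]
    simp only [Category.assoc]
    -- By `hl` the contribution of `b` cancels, leaving `H a ≫ c = c ≫ H (H a)`, the naturality of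
    -- `c`.
    rw [e₄, Category.comp_id, e₃, hl, reassoc_of% e₂, e₁]
    exact c.naturality (a.app (F.obj j).obj)
  let L : (J ⥤ P.FullSubcategory) ⥤ (J ⥤ (Z ⊓ P).FullSubcategory) :=
    (Functor.whiskeringRight J _ _).obj ((Z ⊓ P).lift (P.ι ⋙ H) hQ)
  let S : (J ⥤ (Z ⊓ P).FullSubcategory) ⥤ (J ⥤ P.FullSubcategory) :=
    (Functor.whiskeringRight J _ _).obj (ObjectProperty.ιOfLE inf_le_right)
  have hL : ((qis H P).functorCategory J).IsInvertedBy L := by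
    intro F G f hf
    have : ∀ j, IsIso ((L.map f).app j) := fun j =>
      (ObjectProperty.isIso_hom_iff _).1 (hf j)
    exact NatIso.isIso_of_isIso_app _
  -- Viewing a zero-differential diagram as a diagram with property `P` is a section of cohomology,
  -- by the maps `e`; `α` supplies the other composite.
  let ε : S ⋙ L ≅ 𝟭 _ := (NatIso.ofComponents (fun G => NatIso.ofComponents
    (fun j => (Z ⊓ P).isoMk (@asIso _ _ _ _ (e (G.obj j).obj (G.obj j).property.1) (he _ _)))
    (fun f => InducedCategory.hom_ext (he' _ _ _ _ _)))
    (fun f => NatTrans.ext (funext fun j => InducedCategory.hom_ext (he' _ _ _ _ _)))).symm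
  have hE := isEquivalence_lift_of_section ((qis H P).functorCategory J) L hL S ε α
  -- Cohomology on the homotopy category is the equivalence just obtained followed by a faithful
  -- inclusion, so a morphism is determined by its effect on cohomology.
  have hfaith : (hoCoh H P J).Faithful := by
    have i : Localization.Construction.lift L hL ⋙
        (Functor.whiskeringRight J _ _).obj (Z ⊓ P).ι ≅ hoCoh H P J :=
      eqToIso (Localization.Construction.uniq _ _ (by
        rw [hoCoh, Localization.Construction.fac, ← Functor.assoc, Localization.Construction.fac]
        rfl))
    exact Functor.Faithful.of_iso i
  refine ⟨⟨α, fun F => ⟨hα F, fun β hβ => ?_⟩⟩, ⟨hL, hE⟩⟩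
  refine (hoCoh H P J).map_injective (NatTrans.ext (funext fun j => ?_))
  exact (hβ j).trans (hα F j).symm

end Zigzag

/-! ### Complex embeddings and weights -/

/-- Upper bound: a quotient of the Cauchy sequences of rationals. Lower bound: a complete
nontrivially normed field has at least continuum many elements. -/
theorem mk_padic (ℓ : ℕ) [Fact ℓ.Prime] : Cardinal.mk ℚ_[ℓ] = Cardinal.continuum := by
  apply le_antisymm
  · have h₁ : Cardinal.mk ℚ_[ℓ] ≤ Cardinal.mk (CauSeq ℚ (padicNorm ℓ)) :=
      Cardinal.mk_le_of_surjective (f := CauSeq.Completion.mk) Quotient.mk_surjective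
    have h₂ : Cardinal.mk (CauSeq ℚ (padicNorm ℓ)) ≤ Cardinal.mk (ℕ → ℚ) :=
      Cardinal.mk_le_of_injective (f := Subtype.val) Subtype.val_injective
    refine h₁.trans (h₂.trans ?_)
    simp
  · exact continuum_le_cardinal_of_nontriviallyNormedField _

/-- Steinitz: algebraically closed fields of characteristic zero with the same uncountable
cardinality are isomorphic. Without an embedding, the condition on Weil numbers would be vacuous. -/
theorem exists_complex_embedding (ℓ : ℕ) [Fact ℓ.Prime] :
    Nonempty (AlgebraicClosure ℚ_[ℓ] →+* ℂ) := by
  have h : Cardinal.mk (AlgebraicClosure ℚ_[ℓ]) = Cardinal.continuum := by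
    apply le_antisymm
    · refine (Algebra.IsAlgebraic.cardinalMk_le_max ℚ_[ℓ] _).trans ?_
      rw [mk_padic]
      simp [Cardinal.aleph0_le_continuum]
    · rw [← mk_padic ℓ]
      exact Cardinal.mk_le_of_injective (algebraMap ℚ_[ℓ] (AlgebraicClosure ℚ_[ℓ])).injective
  have : CharZero (AlgebraicClosure ℚ_[ℓ]) :=
    charZero_of_injective_algebraMap (algebraMap ℚ_[ℓ] (AlgebraicClosure ℚ_[ℓ])).injective
  obtain ⟨e⟩ := IsAlgClosed.ringEquiv_of_equiv_of_charZero (K := AlgebraicClosure ℚ_[ℓ]) (L := ℂ)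
    (h ▸ Cardinal.aleph0_lt_continuum) (Cardinal.eq.1 (h.trans Cardinal.mk_complex.symm))
  exact ⟨e.toRingHom⟩

section Weight

variable {k : Type} [Field k]

/-- The weight of a unit `α` with respect to an embedding `τ` of the field into `ℂ`: the real
number `a` with `|τ α| = q ^ (a / 2)`. -/
def weightOf (τ : k →+* ℂ) (q : ℕ) : kˣ →* Multiplicative ℝ where
  toFun α := Multiplicative.ofAdd (2 * Real.log ‖τ (α : k)‖ / Real.log q)
  map_one' := by simp
  map_mul' α β := by
    have hα : ‖τ (α : k)‖ ≠ 0 := by simp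
    have hβ : ‖τ (β : k)‖ ≠ 0 := by simp
    rw [← ofAdd_add, Units.val_mul, map_mul, norm_mul, Real.log_mul hα hβ]
    congr 1
    ring

theorem IsWeilNumber.mem_weightEQ {q : ℕ} (hq : 1 < q) (τ : k →+* ℂ) {a : ℝ} {α : kˣ}
    (h : IsWeilNumber q a α) : α ∈ weightEQ (weightOf τ q) a := by
  have hq' : (1 : ℝ) < q := by exact_mod_cast hq
  have hl : Real.log q ≠ 0 := (Real.log_pos hq').ne'
  change 2 * Real.log ‖τ (α : k)‖ / Real.log q = a
  rw [h τ, Real.log_rpow (by linarith)]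
  field_simp

end Weight

/-! ### Cohomology and homology -/

section Homology

variable {k : Type} [Field k]

/-- Cocycles modulo coboundaries, as homology data. -/
def cohData (K : Cpx k) (i : ℤ) : (K.sc' (i - 1) i (i + 1)).LeftHomologyData where
  K := ModuleCat.of _ (cocycles K i)
  H := ModuleCat.of _ (Coh K i)
  i := ModuleCat.ofHom (cocycles K i).subtype
  π := ModuleCat.ofHom (Submodule.mkQ _)
  wi := by
    ext x
    exact x.2
  hi := ModuleCat.kernelIsLimit _
  wπ := by
    ext x
    exact (Submodule.Quotient.mk_eq_zero _).2 ⟨x, rfl⟩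
  hπ := CokernelCofork.IsColimit.ofπ _ _
    (fun {M} g hg => ModuleCat.ofHom (Submodule.liftQ _ g.hom (by
      rintro ⟨x, hx⟩ ⟨y, rfl⟩
      exact LinearMap.congr_fun (congrArg ModuleCat.Hom.hom hg) y)))
    (fun _ _ => by
      ext x
      rfl)
    (fun _ _ m hm => by
      ext x
      exact LinearMap.congr_fun (congrArg ModuleCat.Hom.hom hm) x)

/-- The homology of a complex is cocycles modulo coboundaries. -/
def homologyIsoCoh (K : Cpx k) (i : ℤ) : K.homology i ≅ ModuleCat.of _ (Coh K i) :=
  ShortComplex.homologyMapIso (K.isoSc' (i - 1) i (i + 1) (by simp) (by simp)) ≪≫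
    (cohData K i).homologyIso

theorem quasiIso_of_cohMap_bijective {K L : Cpx k} (f : K ⟶ L)
    (hf : ∀ i, Function.Bijective (cohMap f i)) : QuasiIso f := by
  refine ⟨fun i => ?_⟩
  rw [quasiIsoAt_iff' f (i - 1) i (i + 1) (by simp) (by simp)]
  let m : ShortComplex.LeftHomologyMapData
      ((HomologicalComplex.shortComplexFunctor' _ _ (i - 1) i (i + 1)).map f)
      (cohData K i) (cohData L i) :=
    { φK := ModuleCat.ofHom (LinearMap.restrict (f.f i).hom (p := cocycles K i)
        (q := cocycles L i) (fun x hx => by rw [mem_cocycles] at hx ⊢; rw [hom_d, hx, map_zero]))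
      φH := ModuleCat.ofHom (cohMap f i)
      commi := rfl
      commf' := by
        rw [← cancel_mono (cohData L i).i]
        ext x
        exact (hom_d f (i - 1) i x).symm
      commπ := rfl }
  rw [m.quasiIso_iff]
  exact (ConcreteCategory.isIso_iff_bijective m.φH).2 (hf i)

end Homology

/-! ### Cohomology of pure complexes -/

section Annihilator

variable {k : Type} [Field k]

instance isNoetherianRing_laurentPolynomial : IsNoetherianRing k[T;T⁻¹] :=
  have := LaurentPolynomial.isLocalization (R := k)
  IsLocalization.isNoetherianRing (Submonoid.powers (Polynomial.X : Polynomial k)) _ inferInstance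

/-- Dévissage over a noetherian ring: a finite module is an iterated extension of quotients by
primes. Each such prime lies in the support, hence is generated by some `t - α`, and annihilators
multiply along extensions. -/
theorem exists_annihilator_of_support_subset {S : Set kˣ} (M : Type) [AddCommGroup M]
    [Module k[T;T⁻¹] M] [h : Module.Finite k[T;T⁻¹] M]
    (hM : Module.support k[T;T⁻¹] M ⊆
      {x | ∃ α ∈ S, x.asIdeal = Ideal.span {T 1 - C (α : k)}}) :
    ∃ p ∈ rootMonoid S, ∀ x : M, p • x = 0 := by
  revert hM
  induction h using IsNoetherianRing.induction_on_isQuotientEquivQuotientPrime with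
  | subsingleton N => exact fun _ => ⟨1, one_mem _, fun x => Subsingleton.elim _ _⟩
  | quotient N p e =>
    intro hN
    have hp : p ∈ Module.support k[T;T⁻¹] N := by
      rw [e.support_eq, Module.mem_support_iff_of_finite, Ideal.annihilator_quotient]
    obtain ⟨α, hα, h⟩ := hN hp
    refine ⟨T 1 - C (α : k), Submonoid.subset_closure ⟨α, hα, rfl⟩, fun x => e.injective ?_⟩
    obtain ⟨y, hy⟩ := Ideal.Quotient.mk_surjective (e x)
    rw [map_smul, map_zero, ← hy, ← Ideal.Quotient.mk_eq_mk, ← Submodule.Quotient.mk_smul,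
      Submodule.Quotient.mk_eq_zero, h]
    exact Ideal.mul_mem_right _ _ (Ideal.mem_span_singleton_self _)
  | exact N₁ N₂ N₃ f g hf hg hfg h₁ h₃ =>
    intro hN
    obtain ⟨p, hp, hp'⟩ := h₁ ((Module.support_subset_of_injective f hf).trans hN)
    obtain ⟨r, hr, hr'⟩ := h₃ ((Module.support_subset_of_surjective g hg).trans hN)
    refine ⟨p * r, mul_mem hp hr, fun x => ?_⟩
    obtain ⟨y, hy⟩ := (hfg (r • x)).1 (by rw [map_smul, hr'])
    rw [mul_smul, ← hy, ← map_smul, hp', map_zero]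

end Annihilator

/-! ### Purity in the derived category -/

section Pure

variable {k : Type} [Field k] [HasDerivedCategory.{w} (ModuleCat.{0} k[T;T⁻¹])] {q : ℕ}

/-- The cohomology of the image of a complex in the derived category. -/
def homologyQIso (K : Cpx k) (i : ℤ) :
    (DerivedCategory.homologyFunctor _ i).obj (DerivedCategory.Q.obj K) ≅
      ModuleCat.of k[T;T⁻¹] (Coh K i) :=
  (DerivedCategory.homologyFunctorFactors _ i).app K ≪≫ homologyIsoCoh K i

theorem isIso_Q_map_of_cohMap_bijective {K L : Cpx k} (f : K ⟶ L)
    (hf : ∀ i, Function.Bijective (cohMap f i)) : IsIso (DerivedCategory.Q.map f) :=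
  (DerivedCategory.isIso_Q_map_iff_quasiIso _ f).2 (quasiIso_of_cohMap_bijective f hf)

theorem IsPure.of_iso {X Y : Der.{w} k} (e : X ≅ Y) (h : IsPure.{w} k q X) :
    IsPure.{w} k q Y := by
  obtain ⟨⟨P, hb, hP, ⟨e'⟩⟩, hs⟩ := h
  refine ⟨⟨P, hb, hP, ⟨e' ≪≫ e⟩⟩, fun i => ?_⟩
  rw [← ((DerivedCategory.homologyFunctor _ i).mapIso e).toLinearEquiv.support_eq]
  exact hs i

theorem isPure_Q_iff_of_cohMap_bijective {K L : Cpx k} (f : K ⟶ L)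
    (hf : ∀ i, Function.Bijective (cohMap f i)) :
    IsPure.{w} k q (DerivedCategory.Q.obj K) ↔ IsPure.{w} k q (DerivedCategory.Q.obj L) := by
  have := isIso_Q_map_of_cohMap_bijective f hf
  exact ⟨.of_iso (asIso (DerivedCategory.Q.map f)),
    .of_iso (asIso (DerivedCategory.Q.map f)).symm⟩

theorem perfect.finite_homology {X : Der.{w} k} (h : perfect.{w} k X) (i : ℤ) :
    Module.Finite k[T;T⁻¹] ((DerivedCategory.homologyFunctor (ModuleCat.{0} k[T;T⁻¹]) i).obj X) := by
  obtain ⟨P, -, hP, ⟨e⟩⟩ := h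
  have := (hP i).1
  exact Module.Finite.equiv ((homologyQIso P i).symm ≪≫
    (DerivedCategory.homologyFunctor _ i).mapIso e).toLinearEquiv

theorem perfect.exists_bound {X : Der.{w} k} (h : perfect.{w} k X) :
    ∃ a b : ℤ, ∀ i, i < a ∨ b < i →
      IsZero ((DerivedCategory.homologyFunctor (ModuleCat.{0} k[T;T⁻¹]) i).obj X) := by
  obtain ⟨P, ⟨a, b, hb⟩, -, ⟨e⟩⟩ := h
  refine ⟨a, b, fun i hi => ?_⟩
  have : Subsingleton (P.X i) := ModuleCat.subsingleton_of_isZero (hb i hi)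
  have hz : IsZero (ModuleCat.of k[T;T⁻¹] (Coh P i)) := ModuleCat.isZero_of_subsingleton _
  exact hz.of_iso ((homologyQIso P i).symm ≪≫
    (DerivedCategory.homologyFunctor _ i).mapIso e).symm

theorem IsPure.exists_annihilator {wt : kˣ →* Multiplicative ℝ}
    (hwt : ∀ (a : ℝ) (α : kˣ), IsWeilNumber q a α → α ∈ weightEQ wt a)
    {X : Der.{w} k} (h : IsPure.{w} k q X) (i : ℤ) :
    ∃ p ∈ rootMonoid (weightEQ wt i),
      ∀ x : (DerivedCategory.homologyFunctor (ModuleCat.{0} k[T;T⁻¹]) i).obj X, p • x = 0 := by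
  have := h.1.finite_homology i
  exact exists_annihilator_of_support_subset _ fun x hx => by
    obtain ⟨α, hα, e⟩ := h.2 i hx
    exact ⟨α, hwt _ _ hα, e⟩

theorem IsPure.hasPureCohomology {wt : kˣ →* Multiplicative ℝ}
    (hwt : ∀ (a : ℝ) (α : kˣ), IsWeilNumber q a α → α ∈ weightEQ wt a)
    {K : Cpx k} (h : IsPure.{w} k q (DerivedCategory.Q.obj K)) : HasPureCohomology wt K := by
  intro i c
  obtain ⟨p, hp, hp'⟩ := h.exists_annihilator hwt i
  refine mem_rootTorsion.2 ⟨p, hp, (homologyQIso K i).symm.toLinearEquiv.injective ?_⟩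
  rw [map_smul, map_zero]
  exact hp' _

end Pure

/-! ### Canonical formality of pure algebras and modules -/

section Formal

variable {k : Type} [Field k] {wt : kˣ →* Multiplicative ℝ}

theorem HasPureCohomology.path {K : Cpx k} (h : HasPureCohomology wt K) :
    HasPureCohomology wt (pathCpx K) :=
  h.of_bijective (pathCpx.incl K) pathCpx.cohMap_incl_bijective

theorem cohMap_weightCpx_incl_pathCpx_bijective {K : Cpx k} (h : HasPureCohomology wt K) (i : ℤ) :
    Function.Bijective (cohMap (weightCpx.incl wt (pathCpx K)) i) :=
  cohMap_weightCpx_incl_bijective h.path (fun _ _ hp _ x => pathCpx.exists_smul_eq hp x) i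

variable [HasDerivedCategory.{w} (ModuleCat.{0} k[T;T⁻¹])] {q : ℕ}

theorem DGAlg.canonicallyFormal_isPure
    (hwt : ∀ (a : ℝ) (α : kˣ), IsWeilNumber q a α → α ∈ weightEQ wt a) :
    CanonicallyFormal.{0, 1, v₂, u₂} (DGAlg.cohFunctor k) (DGAlg.cohSelf k) (DGAlg.zeroDiff k)
      (DGAlg.isPure.{w} q) := by
  have hpure (A : DGAlg k) (hA : DGAlg.isPure.{w} q A) : HasPureCohomology wt A.cpx :=
    IsPure.hasPureCohomology hwt hA
  exact canonicallyFormal_of_zigzag _ _ _ _ (fun A => DGAlg.isIso_cohSelf_app A)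
    (fun A => fun _ _ => rfl) (fun A hA => DGAlg.selfCoh A hA)
    (fun A hA => DGAlg.isIso_selfCoh hA)
    (fun A B hA hB f => DGAlg.hom_ext (zeroSelf_naturality f.map hA hB))
    (fun f hf => isPure_Q_iff_of_cohMap_bijective f.map ((DGAlg.isIso_cohFunctor_map_iff f).1 hf))
    (DGAlg.pathFunctor k) (DGAlg.pathFunctor k ⋙ DGAlg.weightFunctor wt)
    (DGAlg.pathIncl k) (Functor.whiskerLeft (DGAlg.pathFunctor k) (DGAlg.weightIncl wt))
    (fun _ => (DGAlg.isIso_cohFunctor_map_iff _).2 pathCpx.cohMap_incl_bijective)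
    (fun A hA => (DGAlg.isIso_cohFunctor_map_iff _).2
      (cohMap_weightCpx_incl_pathCpx_bijective (hpure A hA)))
    { app := fun X => DGAlg.leading ((DGAlg.pathFunctor k).obj X.obj) (hpure _ X.property).path
      naturality := fun X Y f => DGAlg.leading_naturality ((DGAlg.pathFunctor k).map f.hom) _ _ }
    (fun X => DGAlg.cohFunctor_map_leading _ _)

theorem DGMod.canonicallyFormal_isPure
    (hwt : ∀ (a : ℝ) (α : kˣ), IsWeilNumber q a α → α ∈ weightEQ wt a) :
    CanonicallyFormal.{0, 1, v₂, u₂} (DGMod.cohFunctor k) (DGMod.cohSelf k) (DGMod.zeroDiff k)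
      (DGMod.isPure.{w} q) := by
  have hpure (M : DGMod k) (hM : DGMod.isPure.{w} q M) :
      HasPureCohomology wt M.alg.cpx ∧ HasPureCohomology wt M.cpx :=
    ⟨IsPure.hasPureCohomology hwt hM.1, IsPure.hasPureCohomology hwt hM.2⟩
  exact canonicallyFormal_of_zigzag _ _ _ _ (fun M => DGMod.isIso_cohSelf_app M)
    (fun M => ⟨fun _ _ => rfl, fun _ _ => rfl⟩) (fun M hM => DGMod.selfCoh M hM)
    (fun M hM => DGMod.isIso_selfCoh hM)
    (fun M N hM hN f => DGMod.hom_ext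
      (DGAlg.hom_ext (zeroSelf_naturality f.algMap.map hM.1 hN.1))
      (zeroSelf_naturality f.map hM.2 hN.2))
    (fun f hf => and_congr
      (isPure_Q_iff_of_cohMap_bijective f.algMap.map ((DGMod.isIso_cohFunctor_map_iff f).1 hf).1)
      (isPure_Q_iff_of_cohMap_bijective f.map ((DGMod.isIso_cohFunctor_map_iff f).1 hf).2))
    (DGMod.pathFunctor k) (DGMod.pathFunctor k ⋙ DGMod.weightFunctor wt)
    (DGMod.pathIncl k) (Functor.whiskerLeft (DGMod.pathFunctor k) (DGMod.weightIncl wt))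
    (fun _ => (DGMod.isIso_cohFunctor_map_iff _).2
      ⟨pathCpx.cohMap_incl_bijective, pathCpx.cohMap_incl_bijective⟩)
    (fun M hM => (DGMod.isIso_cohFunctor_map_iff _).2
      ⟨cohMap_weightCpx_incl_pathCpx_bijective (hpure M hM).1,
        cohMap_weightCpx_incl_pathCpx_bijective (hpure M hM).2⟩)
    { app := fun X => DGMod.leading ((DGMod.pathFunctor k).obj X.obj)
        (hpure _ X.property).1.path (hpure _ X.property).2.path
      naturality := fun X Y f =>
        DGMod.leading_naturality ((DGMod.pathFunctor k).map f.hom) _ _ _ _ }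
    (fun X => DGMod.cohFunctor_map_leading _ _ _)

end Formal

/-! ### Complexes that are the sum of their shifted cohomology -/

section SingleSummands

variable {𝒜 : Type u₁} [Category.{v₁} 𝒜] [Preadditive 𝒜] [HasZeroObject 𝒜]
  (K : CochainComplex 𝒜 ℤ) (hK : ∀ i j, K.d i j = 0)

/-- The inclusion of a summand of a complex with zero differential. -/
def singleIncl (i : ℤ) : (HomologicalComplex.single 𝒜 (ComplexShape.up ℤ) i).obj (K.X i) ⟶ K :=
  HomologicalComplex.mkHomFromSingle (𝟙 (K.X i)) fun _ _ => by rw [hK, comp_zero]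

/-- The projection to a summand of a complex with zero differential. -/
def singleProj (i : ℤ) : K ⟶ (HomologicalComplex.single 𝒜 (ComplexShape.up ℤ) i).obj (K.X i) :=
  HomologicalComplex.mkHomToSingle (𝟙 (K.X i)) fun _ _ => by rw [hK, zero_comp]

theorem singleIncl_singleProj (i : ℤ) : singleIncl K hK i ≫ singleProj K hK i = 𝟙 _ := by
  apply HomologicalComplex.from_single_hom_ext
  simp [singleIncl, singleProj]

theorem singleIncl_singleProj_of_ne {i j : ℤ} (h : i ≠ j) :
    singleIncl K hK i ≫ singleProj K hK j = 0 := by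
  apply HomologicalComplex.from_single_hom_ext
  exact (HomologicalComplex.isZero_single_obj_X _ _ _ _ h).eq_of_tgt _ _

theorem sum_singleProj_singleIncl (F : Finset ℤ) (hF : ∀ i ∉ F, IsZero (K.X i)) :
    ∑ i ∈ F, singleProj K hK i ≫ singleIncl K hK i = 𝟙 K := by
  ext n
  have h : (∑ i ∈ F, singleProj K hK i ≫ singleIncl K hK i).f n =
      ∑ i ∈ F, (singleProj K hK i).f n ≫ (singleIncl K hK i).f n :=
    (HomologicalComplex.eval 𝒜 _ n).map_sum _ _
  rw [h]
  by_cases hn : n ∈ F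
  · rw [Finset.sum_eq_single_of_mem n hn fun j _ h => by
      rw [(HomologicalComplex.isZero_single_obj_X (ComplexShape.up ℤ) j (K.X j) n
        h.symm).eq_zero_of_tgt ((singleProj K hK j).f n), zero_comp]]
    simp [singleIncl, singleProj]
  · exact (hF n hn).eq_of_src _ _

end SingleSummands

/-! ### Finite sums of shifted objects in the derived category -/

section Decomposition

open DerivedCategory

variable {𝒜 : Type u₁} [Category.{v₁} 𝒜] [Abelian 𝒜] [HasDerivedCategory.{w} 𝒜]

/-- A decomposition of an object of the derived category as a finite direct sum of objects `N i`
placed in degree `i`. -/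
structure Decomposition (X : DerivedCategory 𝒜) (N : ℤ → 𝒜) where
  /-- the inclusions of the summands -/
  incl : ∀ i, (singleFunctor 𝒜 i).obj (N i) ⟶ X
  /-- the projections to the summands -/
  proj : ∀ i, X ⟶ (singleFunctor 𝒜 i).obj (N i)
  /-- a finite set of degrees outside which the summands vanish -/
  degrees : Finset ℤ
  incl_proj_self : ∀ i, incl i ≫ proj i = 𝟙 _
  incl_proj_of_ne : ∀ i j, i ≠ j → incl i ≫ proj j = 0
  sum_proj_incl : ∑ i ∈ degrees, proj i ≫ incl i = 𝟙 X

namespace Decomposition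

variable {X Y : DerivedCategory 𝒜} {N : ℤ → 𝒜} (D : Decomposition X N)

theorem incl_proj_self_assoc (i : ℤ) (f : (singleFunctor 𝒜 i).obj (N i) ⟶ Y) :
    D.incl i ≫ D.proj i ≫ f = f := by
  rw [← Category.assoc, D.incl_proj_self, Category.id_comp]

theorem incl_proj_of_ne_assoc (i j : ℤ) (h : i ≠ j) (f : (singleFunctor 𝒜 j).obj (N j) ⟶ Y) :
    D.incl i ≫ D.proj j ≫ f = 0 := by
  rw [← Category.assoc, D.incl_proj_of_ne i j h, zero_comp]

/-- A decomposition of a complex with zero differential. -/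
def ofZeroDiff (K : CochainComplex 𝒜 ℤ) (hK : ∀ i j, K.d i j = 0) (F : Finset ℤ)
    (hF : ∀ i ∉ F, IsZero (K.X i)) : Decomposition (Q.obj K) K.X where
  incl i := Q.map (singleIncl K hK i)
  proj i := Q.map (singleProj K hK i)
  degrees := F
  incl_proj_self i := (Q.map_comp _ _).symm.trans
    ((congrArg _ (singleIncl_singleProj K hK i)).trans (Q.map_id _))
  incl_proj_of_ne i j h := (Q.map_comp _ _).symm.trans
    ((congrArg _ (singleIncl_singleProj_of_ne K hK h)).trans (Q.map_zero _ _))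
  sum_proj_incl := by
    rw [← Q.map_id, ← sum_singleProj_singleIncl K hK F hF, Functor.map_sum]
    exact Finset.sum_congr rfl fun i _ => (Q.map_comp _ _).symm

/-- Transport of a decomposition along an isomorphism. -/
def ofIso (e : X ≅ Y) : Decomposition Y N where
  incl i := D.incl i ≫ e.hom
  proj i := e.inv ≫ D.proj i
  degrees := D.degrees
  incl_proj_self i := by simp [D.incl_proj_self]
  incl_proj_of_ne i j h := by simp [D.incl_proj_of_ne i j h]
  sum_proj_incl := by
    have := congrArg (fun f => e.inv ≫ f ≫ e.hom) D.sum_proj_incl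
    simpa [Preadditive.comp_sum, Preadditive.sum_comp] using this

theorem hom_ext_from {f g : X ⟶ Y} (h : ∀ i, D.incl i ≫ f = D.incl i ≫ g) : f = g := by
  rw [← Category.id_comp f, ← Category.id_comp g, ← D.sum_proj_incl]
  simp [Preadditive.sum_comp, h]

theorem hom_ext_to {f g : Y ⟶ X} (h : ∀ i, f ≫ D.proj i = g ≫ D.proj i) : f = g := by
  rw [← Category.comp_id f, ← Category.comp_id g, ← D.sum_proj_incl]
  simp_rw [Preadditive.comp_sum, ← Category.assoc, h]

theorem incl_eq_zero {i : ℤ} (hi : i ∉ D.degrees) : D.incl i = 0 := by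
  rw [← Category.comp_id (D.incl i), ← D.sum_proj_incl, Preadditive.comp_sum]
  refine Finset.sum_eq_zero fun j hj => ?_
  rw [D.incl_proj_of_ne_assoc i j (fun h => hi (h ▸ hj))]

theorem incl_sum_proj {i : ℤ} (s : ∀ i, (singleFunctor 𝒜 i).obj (N i) ⟶ Y) :
    D.incl i ≫ ∑ j ∈ D.degrees, D.proj j ≫ s j = s i := by
  rw [Preadditive.comp_sum]
  by_cases hi : i ∈ D.degrees
  · rw [Finset.sum_eq_single_of_mem i hi fun j _ h => by
      rw [D.incl_proj_of_ne_assoc i j h.symm], D.incl_proj_self_assoc]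
  · have h : 𝟙 ((singleFunctor 𝒜 i).obj (N i)) = 0 := by
      rw [← D.incl_proj_self, D.incl_eq_zero hi, zero_comp]
    rw [← Category.id_comp (s i), h, zero_comp]
    exact Finset.sum_eq_zero fun j _ => by rw [D.incl_eq_zero hi, zero_comp]

/-- The summands form a colimit cofan. -/
def isColimit : IsColimit (Cofan.mk X D.incl) :=
  Cofan.IsColimit.mk _ (fun s => ∑ i ∈ D.degrees, D.proj i ≫ s.inj i)
    (fun s _ => D.incl_sum_proj s.inj)
    (fun s _ hm => D.hom_ext_from fun i => (hm i).trans (D.incl_sum_proj s.inj).symm)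

/-- Apply `H^i` to the sum of projections followed by inclusions: the terms with `j ≠ i` factor
through `H^i` of an object concentrated in degree `j`. -/
theorem map_proj_incl (i : ℤ) : (homologyFunctor 𝒜 i).map (D.proj i) ≫
    (homologyFunctor 𝒜 i).map (D.incl i) = 𝟙 _ := by
  have h : ∀ j ≠ i, (homologyFunctor 𝒜 i).map (D.proj j ≫ D.incl j) = 0 := fun j hj => by
    have : IsZero ((homologyFunctor 𝒜 i).obj ((singleFunctor 𝒜 j).obj (N j))) := by
      obtain h | h := lt_or_gt_of_ne hj
      · exact isZero_of_isLE _ j i h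
      · exact isZero_of_isGE _ j i h
    rw [Functor.map_comp, this.eq_zero_of_tgt ((homologyFunctor 𝒜 i).map (D.proj j)), zero_comp]
  have hs := congrArg (homologyFunctor 𝒜 i).map D.sum_proj_incl
  rw [Functor.map_sum, CategoryTheory.Functor.map_id] at hs
  rw [← Functor.map_comp, ← hs]
  by_cases hi : i ∈ D.degrees
  · exact (Finset.sum_eq_single_of_mem i hi fun j _ hj => h j hj).symm
  · rw [Finset.sum_eq_zero fun j hj => h j fun e => hi (e ▸ hj), D.incl_eq_zero hi, comp_zero,
      Functor.map_zero]

/-- The summands are the cohomology objects. -/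
def homologyIso (i : ℤ) : (homologyFunctor 𝒜 i).obj X ≅ N i where
  hom := (homologyFunctor 𝒜 i).map (D.proj i) ≫
    (singleFunctorCompHomologyFunctorIso 𝒜 i).hom.app (N i)
  inv := (singleFunctorCompHomologyFunctorIso 𝒜 i).inv.app (N i) ≫
    (homologyFunctor 𝒜 i).map (D.incl i)
  hom_inv_id := by
    rw [Category.assoc, Iso.hom_inv_id_app_assoc]
    exact D.map_proj_incl i
  inv_hom_id := by
    rw [Category.assoc, ← Functor.map_comp_assoc, D.incl_proj_self, CategoryTheory.Functor.map_id]
    erw [Category.id_comp]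
    exact Iso.inv_hom_id_app _ _

/-- Every decomposition is a decomposition into the cohomology objects. -/
def normalize : Decomposition X fun i => (homologyFunctor 𝒜 i).obj X where
  incl i := (singleFunctor 𝒜 i).map (D.homologyIso i).hom ≫ D.incl i
  proj i := D.proj i ≫ (singleFunctor 𝒜 i).map (D.homologyIso i).inv
  degrees := D.degrees
  incl_proj_self i := by
    rw [Category.assoc, D.incl_proj_self_assoc, ← Functor.map_comp, Iso.hom_inv_id,
      CategoryTheory.Functor.map_id]
  incl_proj_of_ne i j h := by
    rw [Category.assoc, D.incl_proj_of_ne_assoc i j h, comp_zero]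
  sum_proj_incl := by
    simp_rw [Category.assoc, ← Functor.map_comp_assoc, Iso.inv_hom_id, CategoryTheory.Functor.map_id,
      Category.id_comp]
    exact D.sum_proj_incl

/-- Normalization absorbs the identification of each summand with cohomology, so that the inclusions
induce the identity on `H^i`. -/
theorem map_normalize_incl (i : ℤ) : (homologyFunctor 𝒜 i).map (D.normalize.incl i) =
    (singleFunctorCompHomologyFunctorIso 𝒜 i).hom.app ((homologyFunctor 𝒜 i).obj X) := by
  have h := (singleFunctorCompHomologyFunctorIso 𝒜 i).hom.naturality (D.homologyIso i).hom
  dsimp only [Functor.comp_map, Functor.id_map] at h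
  rw [← cancel_mono (D.homologyIso i).hom]
  refine Eq.trans ?_ h
  change (homologyFunctor 𝒜 i).map (_ ≫ _) ≫ (homologyFunctor 𝒜 i).map (D.proj i) ≫ _ = _
  rw [← Functor.map_comp_assoc, Category.assoc, D.incl_proj_self, Category.comp_id]

/-- Only the component in degree `i` remains. It comes from a morphism of the abelian category by
fullness of the single functor, and `H^i` recovers that morphism. -/
theorem eq_zero_of_homologyFunctor_map_eq_zero {M : 𝒜} {i : ℤ}
    (f : (singleFunctor 𝒜 i).obj M ⟶ X) (hf : (homologyFunctor 𝒜 i).map f = 0)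
    (h : ∀ j ≠ i, f ≫ D.proj j = 0) : f = 0 := by
  refine D.hom_ext_to fun j => ?_
  rw [zero_comp]
  obtain rfl | hj := eq_or_ne j i
  · obtain ⟨g, hg⟩ := (singleFunctor 𝒜 j).map_surjective (f ≫ D.proj j)
    have h' := (singleFunctorCompHomologyFunctorIso 𝒜 j).hom.naturality g
    dsimp only [Functor.comp_map, Functor.id_map] at h'
    rw [hg, Functor.map_comp, hf, zero_comp, zero_comp] at h'
    have : g = 0 := by
      rw [← cancel_epi ((singleFunctorCompHomologyFunctorIso 𝒜 j).hom.app M), comp_zero]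
      exact h'.symm
    rw [← hg, this, Functor.map_zero]
  · exact h j hj

end Decomposition

/-- There are no negative extensions between objects of the abelian category. -/
theorem single_hom_shift_eq_zero {M N : 𝒜} (i : ℤ) {n : ℤ} (hn : n < 0)
    (f : (singleFunctor 𝒜 i).obj M ⟶ ((singleFunctor 𝒜 i).obj N)⟦n⟧) : f = 0 := by
  let e := ((singleFunctors 𝒜).shiftIso n (i - n) i (by omega)).app N
  have h : f ≫ e.hom = 0 := by
    exact TStructure.t.zero (X := (singleFunctor 𝒜 i).obj M)
      (Y := (singleFunctor 𝒜 (i - n)).obj N) _ i (i - n) (by omega)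
  rw [← cancel_mono e.hom, h, zero_comp]

/-- A morphism is the matrix of its components. The diagonal ones vanish by the t-structure; the
hypothesis handles the rest. -/
theorem hom_shift_eq_zero {X Y : DerivedCategory 𝒜} {M N : ℤ → 𝒜} (D : Decomposition X M)
    (E : Decomposition Y N) {n : ℤ} (hn : n < 0)
    (h : ∀ i j, i ≠ j →
      ∀ g : (singleFunctor 𝒜 i).obj (M i) ⟶ ((singleFunctor 𝒜 j).obj (N j))⟦n⟧, g = 0)
    (f : X ⟶ Y⟦n⟧) : f = 0 := by
  have key : ∀ i j, D.incl i ≫ f ≫ (E.proj j)⟦n⟧' = 0 := fun i j => by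
    obtain rfl | hij := eq_or_ne i j
    · exact single_hom_shift_eq_zero i hn _
    · exact h i j hij _
  refine D.hom_ext_from fun i => ?_
  have hE : ∑ j ∈ E.degrees, (E.proj j)⟦n⟧' ≫ (E.incl j)⟦n⟧' = 𝟙 (Y⟦n⟧) := by
    rw [← CategoryTheory.Functor.map_id, ← E.sum_proj_incl, Functor.map_sum]
    simp_rw [Functor.map_comp]
  rw [comp_zero, ← Category.comp_id (D.incl i ≫ f), ← hE, Preadditive.comp_sum]
  refine Finset.sum_eq_zero fun j _ => ?_
  rw [← Category.assoc, Category.assoc (D.incl i), key, zero_comp]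

end Decomposition

/-! ### Decomposition of pure complexes -/

section PureDecomposition

variable {k : Type} [Field k] {wt : kˣ →* Multiplicative ℝ}

theorem bijective_cohMap_leadingMap {K : Cpx k} (hK : HasPureCohomology wt K)
    (h : ∀ i, Function.Bijective (cohMap (weightCpx.incl wt K) i)) (i : ℤ) :
    Function.Bijective (cohMap (leadingMap hK) i) := by
  have e : cohMap (leadingMap hK) i =
      ((cohCpxSelf K).f i).hom ∘ₗ cohMap (weightCpx.incl wt K) i :=
    congrArg (fun f : cohCpx (weightCpx wt K) ⟶ cohCpx (cohCpx K) => (f.f i).hom)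
      (cohCpxMap_leadingMap hK)
  rw [e]
  exact (cohCpxSelf_bijective K i).comp (h i)

theorem isCoprime_of_ne {i j : ℤ} (h : i ≠ j) {p r : k[T;T⁻¹]}
    (hp : p ∈ rootMonoid (weightEQ wt i)) (hr : r ∈ rootMonoid (weightEQ wt j)) : IsCoprime p r :=
  isCoprime_of_disjoint (disjoint_weightEQ wt (by exact_mod_cast h)) hp hr

variable [HasDerivedCategory.{w} (ModuleCat.{0} k[T;T⁻¹])] {q : ℕ}

theorem HasPureCohomology.nonempty_iso_cohCpx {K : Cpx k} (hK : HasPureCohomology wt K) :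
    Nonempty (DerivedCategory.Q.obj (cohCpx K) ≅ DerivedCategory.Q.obj K) := by
  have hw := cohMap_weightCpx_incl_pathCpx_bijective hK
  have h₁ := isIso_Q_map_of_cohMap_bijective (pathCpx.incl K) pathCpx.cohMap_incl_bijective
  have h₂ := isIso_Q_map_of_cohMap_bijective _ hw
  have h₃ := isIso_Q_map_of_cohMap_bijective _ (bijective_cohMap_leadingMap hK.path hw)
  have h₄ : IsIso (cohCpxMap (pathCpx.incl K)) :=
    isIso_of_bijective _ pathCpx.cohMap_incl_bijective
  exact ⟨DerivedCategory.Q.mapIso (asIso (cohCpxMap (pathCpx.incl K))) ≪≫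
    (asIso (DerivedCategory.Q.map (leadingMap hK.path))).symm ≪≫
    asIso (DerivedCategory.Q.map (weightCpx.incl wt (pathCpx K))) ≪≫
    (asIso (DerivedCategory.Q.map (pathCpx.incl K))).symm⟩

theorem IsPure.exists_decomposition
    (hwt : ∀ (a : ℝ) (α : kˣ), IsWeilNumber q a α → α ∈ weightEQ wt a)
    {X : Der.{w} k} (h : IsPure.{w} k q X) :
    ∃ D : Decomposition X fun i => (DerivedCategory.homologyFunctor _ i).obj X,
      ∀ i, (DerivedCategory.homologyFunctor _ i).map (D.incl i) =
        (DerivedCategory.singleFunctorCompHomologyFunctorIso _ i).hom.app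
          ((DerivedCategory.homologyFunctor _ i).obj X) := by
  let e := DerivedCategory.Q.objObjPreimageIso X
  let K : Cpx k := DerivedCategory.Q.objPreimage X
  obtain ⟨e'⟩ := (IsPure.hasPureCohomology hwt (h.of_iso e.symm)).nonempty_iso_cohCpx
  obtain ⟨a, b, hab⟩ := h.1.exists_bound
  let D := (Decomposition.ofZeroDiff (cohCpx K) (fun _ _ => rfl) (Finset.Icc a b) fun i hi =>
    (hab i (by rw [Finset.mem_Icc] at hi; omega)).of_iso ((homologyQIso K i).symm ≪≫
      (DerivedCategory.homologyFunctor _ i).mapIso e)).ofIso (e' ≪≫ e)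
  exact ⟨D.normalize, D.map_normalize_incl⟩

theorem smul_id_single_eq_zero {M : ModuleCat.{0} k[T;T⁻¹]} {p : k[T;T⁻¹]}
    (hp : ∀ x : M, p • x = 0) (i : ℤ) :
    p • 𝟙 ((DerivedCategory.singleFunctor _ i).obj M) = 0 := by
  have h : p • 𝟙 M = 0 := by
    ext x
    exact hp x
  rw [← CategoryTheory.Functor.map_id, ← Functor.map_smul, h, Functor.map_zero]

/-- The group of morphisms is a module over the Laurent polynomials, killed by `p` through the
source and by `r` through the target. -/
theorem hom_eq_zero_of_isCoprime {X Y : Der.{w} k} {p r : k[T;T⁻¹]} (h : IsCoprime p r)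
    (hp : p • 𝟙 X = 0) (hr : r • 𝟙 Y = 0) (f : X ⟶ Y) : f = 0 := by
  refine eq_zero_of_coprime_smul h (x := f) ?_ ?_
  · rw [← Category.id_comp f, ← Linear.smul_comp, hp, zero_comp]
  · rw [← Category.comp_id f, ← Linear.comp_smul, hr, comp_zero]

/-- Components into `H^j` with `j ≠ i` vanish by coprime annihilators, and `H^i` detects the
remaining one. Uniqueness and naturality of the splitting both follow. -/
theorem IsPure.single_hom_eq_zero
    (hwt : ∀ (a : ℝ) (α : kˣ), IsWeilNumber q a α → α ∈ weightEQ wt a)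
    {X : Der.{w} k} (h : IsPure.{w} k q X) {i : ℤ}
    {M : ModuleCat.{0} k[T;T⁻¹]} {p : k[T;T⁻¹]} (hp : p ∈ rootMonoid (weightEQ wt i))
    (hM : ∀ x : M, p • x = 0) (f : (DerivedCategory.singleFunctor _ i).obj M ⟶ X)
    (hf : (DerivedCategory.homologyFunctor _ i).map f = 0) : f = 0 := by
  obtain ⟨D, -⟩ := IsPure.exists_decomposition hwt h
  refine D.eq_zero_of_homologyFunctor_map_eq_zero f hf fun j hj => ?_
  obtain ⟨r, hr, hr'⟩ := h.exists_annihilator hwt j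
  exact hom_eq_zero_of_isCoprime (isCoprime_of_ne hj.symm hp hr) (smul_id_single_eq_zero hM i)
    (smul_id_single_eq_zero hr' j) _

theorem IsPure.single_hom_ext
    (hwt : ∀ (a : ℝ) (α : kˣ), IsWeilNumber q a α → α ∈ weightEQ wt a)
    {X Y : Der.{w} k} (hX : IsPure.{w} k q X) (hY : IsPure.{w} k q Y)
    {i : ℤ} {f g : (DerivedCategory.singleFunctor _ i).obj
      ((DerivedCategory.homologyFunctor _ i).obj X) ⟶ Y}
    (h : (DerivedCategory.homologyFunctor _ i).map f =
      (DerivedCategory.homologyFunctor _ i).map g) : f = g := by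
  obtain ⟨p, hp, hp'⟩ := hX.exists_annihilator hwt i
  refine sub_eq_zero.1 (IsPure.single_hom_eq_zero hwt hY hp hp' (f - g) ?_)
  rw [Functor.map_sub, h, sub_self]

theorem IsPure.hom_shift_eq_zero
    (hwt : ∀ (a : ℝ) (α : kˣ), IsWeilNumber q a α → α ∈ weightEQ wt a)
    {X Y : Der.{w} k} (hX : IsPure.{w} k q X)
    (hY : IsPure.{w} k q Y) {n : ℤ} (hn : n < 0) (f : X ⟶ Y⟦n⟧) : f = 0 := by
  obtain ⟨D, -⟩ := IsPure.exists_decomposition hwt hX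
  obtain ⟨E, -⟩ := IsPure.exists_decomposition hwt hY
  refine PureFormality.hom_shift_eq_zero D E hn (fun i j hij g => ?_) f
  obtain ⟨p, hp, hp'⟩ := hX.exists_annihilator hwt i
  obtain ⟨r, hr, hr'⟩ := hY.exists_annihilator hwt j
  refine hom_eq_zero_of_isCoprime (isCoprime_of_ne hij hp hr) (smul_id_single_eq_zero hp' i) ?_ g
  rw [← CategoryTheory.Functor.map_id, ← Functor.map_smul, smul_id_single_eq_zero hr' j,
    Functor.map_zero]

theorem exists_natural_splitting
    (hwt : ∀ (a : ℝ) (α : kˣ), IsWeilNumber q a α → α ∈ weightEQ wt a) :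
    ∃ s : ∀ i : ℤ, (IsPure.{w} k q).ι ⋙ DerivedCategory.homologyFunctor _ i ⋙
        DerivedCategory.singleFunctor _ i ⟶ (IsPure.{w} k q).ι,
      (∀ (i : ℤ) (K : (IsPure.{w} k q).FullSubcategory),
        (DerivedCategory.homologyFunctor _ i).map ((s i).app K) =
            (DerivedCategory.singleFunctorCompHomologyFunctorIso _ i).hom.app
              ((DerivedCategory.homologyFunctor _ i).obj K.obj) ∧
          ∀ s' : (DerivedCategory.singleFunctor _ i).obj
                ((DerivedCategory.homologyFunctor _ i).obj K.obj) ⟶ K.obj,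
            (DerivedCategory.homologyFunctor _ i).map s' =
                (DerivedCategory.singleFunctorCompHomologyFunctorIso _ i).hom.app
                  ((DerivedCategory.homologyFunctor _ i).obj K.obj) →
              s' = (s i).app K) ∧
      ∀ K : (IsPure.{w} k q).FullSubcategory,
        Nonempty (IsColimit (Cofan.mk K.obj fun i => (s i).app K)) := by
  choose D hD using fun K : (IsPure.{w} k q).FullSubcategory =>
    IsPure.exists_decomposition hwt K.property
  refine ⟨fun i => { app := fun K => (D K).incl i, naturality := fun K L f => ?_ },
    fun i K => ⟨hD K i, fun s' hs' => IsPure.single_hom_ext hwt K.property K.property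
      (hs'.trans (hD K i).symm)⟩, fun K => ⟨(D K).isColimit⟩⟩
  -- Both sides of the naturality square start at `H^i` placed in degree `i`, so comparing them on
  -- `H^i` suffices.
  refine IsPure.single_hom_ext hwt K.property L.property ?_
  rw [Functor.map_comp, Functor.map_comp, hD K i, hD L i]
  exact (DerivedCategory.singleFunctorCompHomologyFunctorIso _ i).hom.naturality
    ((DerivedCategory.homologyFunctor _ i).map f.hom)

end PureDecomposition

end PureFormality

end

theorem corollary4p17 (p r ℓ : ℕ) (hp : p.Prime) (hr : 0 < r) [Fact ℓ.Prime] (hℓ : ℓ ≠ p)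
    [HasDerivedCategory.{w} (ModuleCat.{0} (AlgebraicClosure ℚ_[ℓ])[T;T⁻¹])] :
    -- pure complexes are canonically the sum of their shifted cohomology
    (∃ s : ∀ i : ℤ,
        (PureFormality.IsPure.{w} (AlgebraicClosure ℚ_[ℓ]) (p ^ r)).ι ⋙
            DerivedCategory.homologyFunctor _ i ⋙ DerivedCategory.singleFunctor _ i ⟶
          (PureFormality.IsPure.{w} (AlgebraicClosure ℚ_[ℓ]) (p ^ r)).ι,
      (∀ (i : ℤ) (K : (PureFormality.IsPure.{w} (AlgebraicClosure ℚ_[ℓ]) (p ^ r)).FullSubcategory),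
        (DerivedCategory.homologyFunctor _ i).map ((s i).app K) =
            (DerivedCategory.singleFunctorCompHomologyFunctorIso _ i).hom.app
              ((DerivedCategory.homologyFunctor _ i).obj K.obj) ∧
          ∀ s' : (DerivedCategory.singleFunctor _ i).obj
                ((DerivedCategory.homologyFunctor _ i).obj K.obj) ⟶ K.obj,
            (DerivedCategory.homologyFunctor _ i).map s' =
                (DerivedCategory.singleFunctorCompHomologyFunctorIso _ i).hom.app
                  ((DerivedCategory.homologyFunctor _ i).obj K.obj) →
              s' = (s i).app K) ∧
      ∀ K : (PureFormality.IsPure.{w} (AlgebraicClosure ℚ_[ℓ]) (p ^ r)).FullSubcategory,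
        Nonempty (IsColimit (Cofan.mk K.obj fun i => (s i).app K))) ∧
    -- negative extensions between pure complexes vanish
    (∀ K L : PureFormality.Der.{w} (AlgebraicClosure ℚ_[ℓ]),
      PureFormality.IsPure.{w} (AlgebraicClosure ℚ_[ℓ]) (p ^ r) K →
      PureFormality.IsPure.{w} (AlgebraicClosure ℚ_[ℓ]) (p ^ r) L →
      ∀ n : ℤ, n < 0 → ∀ f : K ⟶ L⟦n⟧, f = 0) ∧
    -- pure algebras are canonically formal
    PureFormality.CanonicallyFormal.{0, 1, v₂, u₂}
      (PureFormality.DGAlg.cohFunctor (AlgebraicClosure ℚ_[ℓ]))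
      (PureFormality.DGAlg.cohSelf (AlgebraicClosure ℚ_[ℓ]))
      (PureFormality.DGAlg.zeroDiff (AlgebraicClosure ℚ_[ℓ]))
      (PureFormality.DGAlg.isPure.{w} (p ^ r)) ∧
    -- pure modules over pure algebras are canonically formal
    PureFormality.CanonicallyFormal.{0, 1, v₂, u₂}
      (PureFormality.DGMod.cohFunctor (AlgebraicClosure ℚ_[ℓ]))
      (PureFormality.DGMod.cohSelf (AlgebraicClosure ℚ_[ℓ]))
      (PureFormality.DGMod.zeroDiff (AlgebraicClosure ℚ_[ℓ]))
      (PureFormality.DGMod.isPure.{w} (p ^ r)) := by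
  -- A single embedding suffices: the Weil condition at `τ` alone determines the weight, as `1 < q`
  -- makes `log q` nonzero.
  obtain ⟨τ⟩ := PureFormality.exists_complex_embedding ℓ
  have hq : 1 < p ^ r := Nat.one_lt_pow hr.ne' hp.one_lt
  have hwt : ∀ (a : ℝ) (α : (AlgebraicClosure ℚ_[ℓ])ˣ), PureFormality.IsWeilNumber (p ^ r) a α →
      α ∈ PureFormality.weightEQ (PureFormality.weightOf τ (p ^ r)) a :=
    fun _ _ h => h.mem_weightEQ hq τ
  exact ⟨PureFormality.exists_natural_splitting hwt,
    fun K L hK hL n hn f => PureFormality.IsPure.hom_shift_eq_zero hwt hK hL hn f,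
    PureFormality.DGAlg.canonicallyFormal_isPure hwt,
    PureFormality.DGMod.canonicallyFormal_isPure hwt⟩
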